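/- Let $f:\mathbb{R}\to\mathbb{C}$ be a centred complex Gaussian stationary process with almost surely continuously differentiable sample paths; that is, every vector $(f(t_1),\dots,f(t_n))$ has the law of $A\mathbf v$, where $A$ is a complex matrix and the entries of $\mathbf v$ are i.i.d. with density $\frac1\pi e^{-|z|^2}$ on $\mathbb{C}$, and these laws are invariant under real shifts. Suppose that its covariance kernel $r(t)=\mathbb{E}[f(t)\overline{f(0)}]$ satisfies $r(t)=\int_{\mathbb{R}}e^{-it\lambda}\,d\rho(\lambda)$ for all $t\in\mathbb{R}$, where the spectral measure $\rho$ is a probability measure on $\mathbb{R}$ (so $r(0)=1$) which is not a unit mass at a single point and satisfies, for some $\alpha>0$, $$\int_{\mathbb{R}}\lambda^2\log^{1+\alpha}(1+|\lambda|)\,d\rho(\lambda)<\infty .$$ For $T>0$ let $$\Delta(T)=\frac1{2i}\int_0^T\left[\frac{f'(t)}{f(t)}-\overline{\left(\frac{f'(t)}{f(t)}\right)}\right]dt$$ be the winding of $f$ around the origin in the interval $[0,T]$. Then there exist $C>0$ and $T_0>0$, depending only on $r$, such that for all $T\ge T_0$ the random variable $\Delta(T)$ is square-integrable and $$\operatorname{Var}[\Delta(T)]\ge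 C\,T .$$ -/

import Mathlib

open MeasureTheory ProbabilityTheory
open scoped Matrix ComplexConjugate

/-- The standard complex Gaussian distribution: density `π⁻¹ exp (-|z|²)` on `ℂ`. -/
noncomputable def stdComplexGaussian : Measure ℂ :=
  (volume : Measure ℂ).withDensity
    (fun z => ENNReal.ofReal (Real.pi⁻¹ * Real.exp (-‖z‖ ^ 2)))

/-- `X` is a (centred) complex Gaussian vector: its law is the law of `A v`, where the entries
of `v` are i.i.d. standard complex Gaussians and `A` is a complex matrix. -/
def IsComplexGaussianVector {Ω : Type*} [MeasurableSpace Ω] {n : ℕ}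
    (X : Ω → Fin n → ℂ) (P : Measure Ω) : Prop :=
  AEMeasurable X P ∧
    ∃ (m : ℕ) (A : Matrix (Fin n) (Fin m) ℂ),
      P.map X = (Measure.pi (fun _ : Fin m => stdComplexGaussian)).map (fun v => A *ᵥ v)

/-- `f` is a (centred) complex Gaussian stationary process on `ℝ`: all finite marginals are
complex Gaussian vectors, and their laws are invariant under real shifts. -/
structure IsGSP {Ω : Type*} [MeasurableSpace Ω] (f : ℝ → Ω → ℂ) (P : Measure Ω) : Prop where
  gaussian : ∀ (n : ℕ) (t : Fin n → ℝ), IsComplexGaussianVector (fun ω i => f (t i) ω) P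
  stationary : ∀ (n : ℕ) (t : Fin n → ℝ) (s : ℝ),
    P.map (fun ω i => f (t i + s) ω) = P.map (fun ω i => f (t i) ω)

/-- The covariance kernel `r(t) = E[f(t) conj (f(0))]`. -/
noncomputable def covarianceKernel {Ω : Type*} [MeasurableSpace Ω]
    (f : ℝ → Ω → ℂ) (P : Measure Ω) (t : ℝ) : ℂ :=
  ∫ ω, f t ω * conj (f 0 ω) ∂P

/-- `ρ` is the spectral measure of the (normalized, `r(0) = 1`) covariance kernel `r`:
a probability measure with `r(t) = ∫ exp (-i t l) dρ(l)`. -/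
def IsSpectralMeasure (r : ℝ → ℂ) (ρ : Measure ℝ) : Prop :=
  IsProbabilityMeasure ρ ∧
    ∀ t : ℝ, r t = ∫ l : ℝ, Complex.exp (-Complex.I * (t : ℂ) * (l : ℂ)) ∂ρ

/-- The log-moment condition: `∫ l² log^(1+α) (1+|l|) dρ(l) < ∞` for some `α > 0`. -/
def LogMomentCondition (ρ : Measure ℝ) : Prop :=
  ∃ α : ℝ, 0 < α ∧
    Integrable (fun l : ℝ => l ^ 2 * Real.log (1 + |l|) ^ (1 + α)) ρ

/-- Degenerate spectral measure: a unit mass at one point. -/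
def IsDegenerate (ρ : Measure ℝ) : Prop :=
  ∃ φ : ℝ, ρ = Measure.dirac φ

/-- The winding (increment of the argument) of a path `g` around the origin on `[0, T]`:
`∫₀ᵀ Im (g'(t) / g(t)) dt`. -/
noncomputable def winding (g : ℝ → ℂ) (T : ℝ) : ℝ :=
  ∫ t in (0 : ℝ)..T, (deriv g t / g t).im

/-- The winding as `(2i)⁻¹ ∫₀ᵀ [g'/g - conj (g'/g)] dt`. -/
theorem winding_eq (g : ℝ → ℂ) (T : ℝ) :
    (winding g T : ℂ) =
      1 / (2 * Complex.I) * ∫ t in (0 : ℝ)..T, (deriv g t / g t - conj (deriv g t / g t)) := by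
  have h : ∀ z : ℂ, z - conj z = (2 * Complex.I) * ((z.im : ℝ) : ℂ) := by
    intro z
    rw [Complex.sub_conj]
    push_cast
    ring
  simp only [h]
  rw [intervalIntegral.integral_const_mul, intervalIntegral.integral_ofReal, winding,
    ← mul_assoc, one_div, inv_mul_cancel₀, one_mul]
  simp

/-! ### The standard complex Gaussian law: moments and rotation invariance -/

section StdComplexGaussian

/-! The variance is bounded below by projecting the winding onto a quadratic functional of the
process. Let `φ` be the mean of `ρ` and `w = f' + iφf`; this choice makes `w(t)` orthogonal to
`f(t)`, hence independent of it. Put `Δ = ∫ Im(f'/f)` and `Q = ∫ Im(w · conj f)` over `[0,T]`. Up to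
the constant `φ`, the two integrands are `Im(w · N(f))` with `N(z) = z⁻¹` and `N(z) = conj z`. Both
choices of `N` turn with the phase of `z⁻¹` and satisfy `E[z N(z)] = 1` for a standard Gaussian `z`.
A Wick-type computation (`IsIsonormal.dualFactor_wick`) sees nothing else of `N`, so each integrand
has the same covariance with the quadratic one at another time. Hence `E[ΔQ] = E[Q²]`, while `E[Q] =
0`, and expanding `(Δ - EΔ - Q)² ≥ 0` gives `Var Δ ≥ E[Q²]`.

On the spectral side, `E[Q²]` is one quarter of the integral of `(x + y - 2φ)²` times a nonnegative
Fejér-type kernel in `x - y`, against `ρ ⊗ ρ`. The kernel is at least `T²/4` when `|x - y| ≤ 1/T`.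
As `ρ` is not a point mass, some bounded set `A` on one side of `φ` and away from it is charged;
cutting it into about `T` cells and applying Cauchy-Schwarz shows that the strip `|x - y| ≤ 1/T` in
`A × A` has mass at least of order `1/T`. The product is of order `T`.

The pairing `E[ΔQ]` and Fubini need `Δ` in `L²`. Although `1/f(t)` itself is not square-integrable,
for `s ≠ t` the mean of `|f'(s)/f(s)| |f'(t)/f(t)|` is at most `A + B|s - t|^(-3/5)` locally
(`IsIsonormal.lintegral_two_point_le`), because `1 - |r(t)|²` is at least quadratic in `t` near
zero. This singularity is integrable in time.

All Gaussian facts are phrased for pairs made of a random variable and its representative in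
`L²(ρ)`, so that orthogonality in `L²(ρ)` means independence. The derivative enters this family as a
limit of difference quotients. -/

theorem lintegral_stdComplexGaussian_density :
    ∫⁻ z : ℂ, ENNReal.ofReal (Real.pi⁻¹ * Real.exp (-‖z‖ ^ 2)) = 1 := by
  have h := GaussianFourier.integral_rexp_neg_mul_sq_norm (V := ℂ) (b := 1) one_pos
  have hpos : (0 : ℝ) < ∫ z : ℂ, Real.exp (-1 * ‖z‖ ^ 2) := by
    rw [h]; simp [Real.pi_pos]
  have hint : Integrable (fun z : ℂ => Real.exp (-1 * ‖z‖ ^ 2)) :=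
    not_imp_comm.1 integral_undef hpos.ne'
  simp only [neg_mul, one_mul] at hint h
  rw [← ofReal_integral_eq_lintegral_ofReal (hint.const_mul _)
    (Filter.Eventually.of_forall fun z => by positivity), integral_const_mul, h]
  simp [Real.pi_pos.ne']

instance isProbabilityMeasure_stdComplexGaussian :
    IsProbabilityMeasure stdComplexGaussian :=
  ⟨by rw [stdComplexGaussian, withDensity_apply _ MeasurableSet.univ, setLIntegral_univ,
    lintegral_stdComplexGaussian_density]⟩

theorem measurable_stdComplexGaussian_density :
    Measurable (fun z : ℂ => ENNReal.ofReal (Real.pi⁻¹ * Real.exp (-‖z‖ ^ 2))) := by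
  fun_prop

theorem integral_stdComplexGaussian (g : ℂ → ℂ) :
    ∫ z, g z ∂stdComplexGaussian =
      ∫ z : ℂ, (Real.pi⁻¹ * Real.exp (-‖z‖ ^ 2)) • g z := by
  rw [stdComplexGaussian, integral_withDensity_eq_integral_toReal_smul
    measurable_stdComplexGaussian_density (by simp)]
  refine integral_congr_ae (Filter.Eventually.of_forall fun z => ?_)
  simp only
  rw [ENNReal.toReal_ofReal (by positivity)]

theorem charFun_stdComplexGaussian (t : ℂ) :
    charFun stdComplexGaussian t = Complex.exp (-(‖t‖ ^ 2 : ℝ) / 4) := by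
  have h := GaussianFourier.integral_cexp_neg_mul_sq_norm_add (V := ℂ) (b := 1)
    (by simp) Complex.I t
  rw [charFun_apply, integral_stdComplexGaussian]
  have : ∀ z : ℂ, (Real.pi⁻¹ * Real.exp (-‖z‖ ^ 2)) • Complex.exp ((inner ℝ z t : ℝ) * Complex.I)
      = (Real.pi⁻¹ : ℂ) * Complex.exp (-1 * (‖z‖ : ℂ) ^ 2 + Complex.I * (inner ℝ t z : ℝ)) := by
    intro z
    rw [Complex.exp_add, real_inner_comm]
    simp only [Complex.real_smul]
    push_cast
    rw [mul_comm Complex.I]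
    ring_nf
  simp only [this]
  rw [integral_const_mul, h]
  simp [Complex.I_sq]

/-- In the plane `‖z‖ ^ q` is locally integrable exactly for `q > -2`. Integrability is read off
from the Gamma formula: a nonzero Bochner integral cannot come from a nonintegrable function. -/
theorem integrable_norm_rpow_stdComplexGaussian {q : ℝ} (hq : -2 < q) :
    Integrable (fun z : ℂ => ‖z‖ ^ q) stdComplexGaussian := by
  have h := Complex.integral_rpow_mul_exp_neg_rpow (p := 2) (q := q) (by norm_num) hq
  have hpos : (0 : ℝ) < ∫ z : ℂ, ‖z‖ ^ q * Real.exp (-‖z‖ ^ (2 : ℝ)) := by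
    rw [h]
    have := Real.Gamma_pos_of_pos (s := (q + 2) / 2) (by linarith)
    have := Real.pi_pos
    positivity
  have hint : Integrable (fun z : ℂ => ‖z‖ ^ q * Real.exp (-‖z‖ ^ (2 : ℝ))) :=
    not_imp_comm.1 integral_undef hpos.ne'
  rw [stdComplexGaussian, integrable_withDensity_iff_integrable_smul₀'
    measurable_stdComplexGaussian_density.aemeasurable (by simp)]
  refine (hint.const_mul Real.pi⁻¹).congr (Filter.Eventually.of_forall fun z => ?_)
  simp only [smul_eq_mul, Real.rpow_two]
  rw [ENNReal.toReal_ofReal (by positivity)]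
  ring

theorem stdComplexGaussian_singleton (z : ℂ) : stdComplexGaussian {z} = 0 :=
  withDensity_absolutelyContinuous _ _ (by simp)

theorem memLp_id_stdComplexGaussian {q : ENNReal} (hq : q ≠ ⊤) :
    MemLp (fun z : ℂ => z) q stdComplexGaussian := by
  by_cases h0 : q = 0
  · subst h0; exact memLp_zero_iff_aestronglyMeasurable.2 (by fun_prop)
  rw [← integrable_norm_rpow_iff (by fun_prop) h0 hq]
  exact integrable_norm_rpow_stdComplexGaussian
    (by have := ENNReal.toReal_nonneg (a := q); linarith)

theorem map_mul_stdComplexGaussian {c : ℂ} (hc : ‖c‖ = 1) :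
    stdComplexGaussian.map (fun z => c * z) = stdComplexGaussian := by
  refine Measure.ext_of_charFun ?_
  ext t
  rw [charFun_apply, integral_map (by fun_prop) (by fun_prop)]
  have : ∀ z : ℂ, inner ℝ (c * z) t = inner ℝ z (conj c * t) := by
    intro z
    simp only [Complex.inner, map_mul]
    congr 1; ring
  simp only [this]
  rw [← charFun_apply (E := ℂ), charFun_stdComplexGaussian, charFun_stdComplexGaussian]
  simp [hc]

/-- Rotation invariance of the law forces the integral to equal `d` times itself. This kills every
unwanted term of the Wick computation. -/
theorem integral_eq_zero_of_rotation {g : ℂ → ℂ} {c d : ℂ} (hc : ‖c‖ = 1) (hd : d ≠ 1)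
    (hg : ∀ z, g (c * z) = d * g z) : ∫ z, g z ∂stdComplexGaussian = 0 := by
  have hc0 : c ≠ 0 := by rintro rfl; simp at hc
  have h : ∫ z, g z ∂stdComplexGaussian = d * ∫ z, g z ∂stdComplexGaussian := by
    conv_lhs => rw [← map_mul_stdComplexGaussian hc]
    have := (MeasurableEquiv.mulLeft₀ c hc0).measurableEmbedding.integral_map
      (μ := stdComplexGaussian) g
    simp only [MeasurableEquiv.coe_mulLeft₀] at this
    rw [this, ← integral_const_mul]
    simp [hg]
  have h2 : (1 - d) * ∫ z, g z ∂stdComplexGaussian = 0 := by linear_combination h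
  exact (mul_eq_zero.1 h2).resolve_left (sub_ne_zero.2 hd.symm)

theorem integral_norm_sq_stdComplexGaussian :
    ∫ z : ℂ, ‖z‖ ^ 2 ∂stdComplexGaussian = 1 := by
  have h := Complex.integral_rpow_mul_exp_neg_rpow (p := 2) (q := 2) (by norm_num) (by norm_num)
  rw [stdComplexGaussian, integral_withDensity_eq_integral_toReal_smul
    measurable_stdComplexGaussian_density (by simp)]
  have : ∀ z : ℂ, (ENNReal.ofReal (Real.pi⁻¹ * Real.exp (-‖z‖ ^ 2))).toReal • ‖z‖ ^ 2
      = Real.pi⁻¹ * (‖z‖ ^ (2 : ℝ) * Real.exp (-‖z‖ ^ (2 : ℝ))) := by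
    intro z
    rw [ENNReal.toReal_ofReal (by positivity)]
    simp only [smul_eq_mul, Real.rpow_two]; ring
  simp only [this]
  rw [integral_const_mul, h]
  norm_num

end StdComplexGaussian

/-! ### Gaussian families represented in `L²(ρ)` -/

section Isonormal

variable {Ω E : Type*} [MeasurableSpace Ω] [MeasurableSpace E]

/-- `ξ` is a centred circularly symmetric complex Gaussian variable of variance `∫ ‖h‖² dρ`. -/
structure GaussianPair (P : Measure Ω) (ρ : Measure E) (p : (Ω → ℂ) × (E → ℂ)) : Prop where
  aemeasurable : AEMeasurable p.1 P
  memLp : MemLp p.2 2 ρ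
  integral_exp : ∫ ω, Complex.exp ((p.1 ω).re * Complex.I) ∂P =
    Complex.exp (-(∫ x, ‖p.2 x‖ ^ 2 ∂ρ : ℝ) / 4)

/-- A linear family of Gaussian variables, represented in `L²(ρ)`. -/
def IsIsonormal (P : Measure Ω) (ρ : Measure E) (S : Submodule ℂ ((Ω → ℂ) × (E → ℂ))) : Prop :=
  ∀ p ∈ S, GaussianPair P ρ p

variable {P : Measure Ω} {ρ : Measure E}
  {S : Submodule ℂ ((Ω → ℂ) × (E → ℂ))}

/-- The definition prescribes only one value of a characteristic function per pair; since `S` is a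
complex subspace, replacing `p` by `conj t • p` recovers all the others, and with them the law. -/
theorem IsIsonormal.charFun (hS : IsIsonormal P ρ S) {p : (Ω → ℂ) × (E → ℂ)} (hp : p ∈ S)
    (t : ℂ) : charFun (P.map p.1) t =
      Complex.exp (-(‖t‖ ^ 2 * ∫ x, ‖p.2 x‖ ^ 2 ∂ρ : ℝ) / 4) := by
  have h := (hS _ (S.smul_mem (conj t) hp)).integral_exp
  rw [charFun_apply, integral_map (hS p hp).aemeasurable (by fun_prop)]
  simp only [Prod.smul_fst, Pi.smul_apply, smul_eq_mul, Prod.smul_snd, norm_mul,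
    RCLike.norm_conj, mul_pow] at h
  rw [integral_const_mul] at h
  rw [← h]
  refine integral_congr_ae (Filter.Eventually.of_forall fun ω => ?_)
  simp only [Complex.inner]
  rw [← Complex.conj_re]
  simp

theorem IsIsonormal.map_eq [IsProbabilityMeasure P] (hS : IsIsonormal P ρ S) {p : (Ω → ℂ) × (E → ℂ)} (hp : p ∈ S) :
    P.map p.1 =
      stdComplexGaussian.map (fun z => Real.sqrt (∫ x, ‖p.2 x‖ ^ 2 ∂ρ) • z) := by
  have := Measure.isProbabilityMeasure_map (hS p hp).aemeasurable
  refine Measure.ext_of_charFun ?_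
  ext t
  rw [hS.charFun hp, charFun_map_smul, charFun_stdComplexGaussian, norm_smul, mul_pow]
  have h0 : 0 ≤ ∫ x, ‖p.2 x‖ ^ 2 ∂ρ := integral_nonneg fun x => by positivity
  rw [Real.norm_eq_abs, sq_abs, Real.sq_sqrt h0, mul_comm]

theorem IsIsonormal.map_eq_std [IsProbabilityMeasure P] (hS : IsIsonormal P ρ S) {p : (Ω → ℂ) × (E → ℂ)} (hp : p ∈ S)
    (h1 : ∫ x, ‖p.2 x‖ ^ 2 ∂ρ = 1) : P.map p.1 = stdComplexGaussian := by
  rw [hS.map_eq hp, h1]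
  simp

theorem IsIsonormal.memLp [IsProbabilityMeasure P] (hS : IsIsonormal P ρ S) {p : (Ω → ℂ) × (E → ℂ)} (hp : p ∈ S)
    {q : ENNReal} (hq : q ≠ ⊤) : MemLp p.1 q P := by
  have h : MemLp (fun z : ℂ => z) q (P.map p.1) := by
    rw [hS.map_eq hp, memLp_map_measure_iff (by fun_prop) (by fun_prop)]
    have := (memLp_id_stdComplexGaussian hq).const_smul (Real.sqrt (∫ x, ‖p.2 x‖ ^ 2 ∂ρ))
    exact this
  exact (memLp_map_measure_iff (by fun_prop) (hS p hp).aemeasurable).1 h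

theorem IsIsonormal.integral_norm_sq [IsProbabilityMeasure P] (hS : IsIsonormal P ρ S) {p : (Ω → ℂ) × (E → ℂ)}
    (hp : p ∈ S) : ∫ ω, ‖p.1 ω‖ ^ 2 ∂P = ∫ x, ‖p.2 x‖ ^ 2 ∂ρ := by
  have h0 : 0 ≤ ∫ x, ‖p.2 x‖ ^ 2 ∂ρ := integral_nonneg fun x => by positivity
  rw [← integral_map (f := fun z : ℂ => ‖z‖ ^ 2) (hS p hp).aemeasurable (by fun_prop),
    hS.map_eq hp, integral_map (by fun_prop) (by fun_prop)]
  simp only [norm_smul, mul_pow, Real.norm_eq_abs, sq_abs, Real.sq_sqrt h0]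
  rw [integral_const_mul, integral_norm_sq_stdComplexGaussian, mul_one]

theorem memLp_two_mul_conj {α : Type*} [MeasurableSpace α] {μ : Measure α} {f g : α → ℂ}
    (hf : MemLp f 2 μ) (hg : MemLp g 2 μ) : Integrable (fun x => f x * conj (g x)) μ :=
  hf.integrable_mul hg.star

theorem norm_add_smul_sq (a b c : ℂ) :
    ‖a + c * b‖ ^ 2 = ‖a‖ ^ 2 + ‖c‖ ^ 2 * ‖b‖ ^ 2 + 2 * (conj c * (a * conj b)).re := by
  simp only [Complex.sq_norm, Complex.normSq_add, map_mul]
  congr 2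
  congr 1; ring

theorem integral_norm_add_smul_sq {α : Type*} [MeasurableSpace α] {μ : Measure α} {f g : α → ℂ}
    (hf : MemLp f 2 μ) (hg : MemLp g 2 μ) (c : ℂ) :
    ∫ x, ‖f x + c * g x‖ ^ 2 ∂μ = ∫ x, ‖f x‖ ^ 2 ∂μ + ‖c‖ ^ 2 * ∫ x, ‖g x‖ ^ 2 ∂μ
      + 2 * (conj c * ∫ x, f x * conj (g x) ∂μ).re := by
  have h1 := hf.integrable_norm_pow (p := 2) (by norm_num)
  have h2 := hg.integrable_norm_pow (p := 2) (by norm_num)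
  have h3 := (memLp_two_mul_conj hf hg).const_mul (conj c)
  have h12 : Integrable (fun x => ‖f x‖ ^ 2 + ‖c‖ ^ 2 * ‖g x‖ ^ 2) μ := h1.add (h2.const_mul _)
  have h3' : Integrable (fun x => 2 * (conj c * (f x * conj (g x))).re) μ := h3.re.const_mul 2
  simp only [norm_add_smul_sq]
  rw [integral_add h12 h3', integral_add h1 (h2.const_mul _), integral_const_mul, integral_const_mul]
  congr 2
  rw [← integral_const_mul]
  exact integral_re h3

/-- Polarization of the isometry `integral_norm_sq`: the multipliers `1` and `I` give the real and
imaginary parts. -/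
theorem IsIsonormal.integral_mul_conj [IsProbabilityMeasure P] (hS : IsIsonormal P ρ S) {p q : (Ω → ℂ) × (E → ℂ)}
    (hp : p ∈ S) (hq : q ∈ S) :
    ∫ ω, p.1 ω * conj (q.1 ω) ∂P = ∫ x, p.2 x * conj (q.2 x) ∂ρ := by
  have key : ∀ c : ℂ, (conj c * ∫ ω, p.1 ω * conj (q.1 ω) ∂P).re =
      (conj c * ∫ x, p.2 x * conj (q.2 x) ∂ρ).re := by
    intro c
    have h := hS.integral_norm_sq (S.add_mem hp (S.smul_mem c hq))
    simp only [Prod.fst_add, Prod.snd_add, Prod.smul_fst, Prod.smul_snd, Pi.add_apply,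
      Pi.smul_apply, smul_eq_mul] at h
    rw [integral_norm_add_smul_sq (hS.memLp hp (by simp)) (hS.memLp hq (by simp)),
      integral_norm_add_smul_sq (hS p hp).memLp (hS q hq).memLp,
      hS.integral_norm_sq hp, hS.integral_norm_sq hq] at h
    linarith
  apply Complex.ext
  · simpa using key 1
  · simpa using key Complex.I

theorem realLinear_eq_re (L : ℂ →L[ℝ] ℝ) (z : ℂ) :
    L z = ((L 1 - L Complex.I * Complex.I) * z : ℂ).re := by
  conv_lhs => rw [← Complex.re_add_im z]
  have h1 : (z.re : ℂ) = z.re • (1 : ℂ) := by simp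
  have h2 : (z.im : ℂ) * Complex.I = z.im • Complex.I := by simp
  rw [map_add, h1, h2, map_smul, map_smul]
  simp
  ring

/-- A real-linear functional of the four variables is the real part of an element of `S`. By
orthogonality its squared norm splits by Pythagoras, so the joint characteristic function factors.
Three partners are exactly what the Wick computation needs. -/
theorem IsIsonormal.indepFun [IsProbabilityMeasure P] (hS : IsIsonormal P ρ S) {p q₁ q₂ q₃ : (Ω → ℂ) × (E → ℂ)}
    (hp : p ∈ S) (hq₁ : q₁ ∈ S) (hq₂ : q₂ ∈ S) (hq₃ : q₃ ∈ S)
    (h₁ : ∫ x, q₁.2 x * conj (p.2 x) ∂ρ = 0) (h₂ : ∫ x, q₂.2 x * conj (p.2 x) ∂ρ = 0)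
    (h₃ : ∫ x, q₃.2 x * conj (p.2 x) ∂ρ = 0) :
    IndepFun p.1 (fun ω => (q₁.1 ω, q₂.1 ω, q₃.1 ω)) P := by
  have mp := (hS p hp).aemeasurable
  have m₁ := (hS _ hq₁).aemeasurable
  have m₂ := (hS _ hq₂).aemeasurable
  have m₃ := (hS _ hq₃).aemeasurable
  have mq : AEMeasurable (fun ω => (q₁.1 ω, q₂.1 ω, q₃.1 ω)) P :=
    m₁.prodMk (m₂.prodMk m₃)
  rw [indepFun_iff_charFunDual_prod mp mq]
  intro L
  obtain ⟨a, ha⟩ : ∃ a : ℂ, ∀ z : ℂ, L (z, 0) = (a * z).re :=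
    ⟨_, fun z => realLinear_eq_re (L.comp (.inl ℝ _ _)) z⟩
  obtain ⟨b₁, hb₁⟩ : ∃ a : ℂ, ∀ z : ℂ, L (0, z, 0, 0) = (a * z).re :=
    ⟨_, fun z => realLinear_eq_re ((L.comp (.inr ℝ _ _)).comp (.inl ℝ _ _)) z⟩
  obtain ⟨b₂, hb₂⟩ : ∃ a : ℂ, ∀ z : ℂ, L (0, 0, z, 0) = (a * z).re :=
    ⟨_, fun z => realLinear_eq_re (((L.comp (.inr ℝ _ _)).comp (.inr ℝ _ _)).comp
      (.inl ℝ _ _)) z⟩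
  obtain ⟨b₃, hb₃⟩ : ∃ a : ℂ, ∀ z : ℂ, L (0, 0, 0, z) = (a * z).re :=
    ⟨_, fun z => realLinear_eq_re (((L.comp (.inr ℝ _ _)).comp (.inr ℝ _ _)).comp
      (.inr ℝ _ _)) z⟩
  set q : (Ω → ℂ) × (E → ℂ) := b₁ • q₁ + b₂ • q₂ + b₃ • q₃ with hq
  have hqS : q ∈ S :=
    S.add_mem (S.add_mem (S.smul_mem _ hq₁) (S.smul_mem _ hq₂)) (S.smul_mem _ hq₃)
  have hLq : ∀ z₁ z₂ z₃ : ℂ, L (0, z₁, z₂, z₃) = (b₁ * z₁ + b₂ * z₂ + b₃ * z₃).re := by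
    intro z₁ z₂ z₃
    have : ((0, z₁, z₂, z₃) : ℂ × ℂ × ℂ × ℂ) = (0, z₁, 0, 0) + (0, 0, z₂, 0) + (0, 0, 0, z₃) := by
      simp
    rw [this, map_add, map_add, hb₁, hb₂, hb₃]
    simp
  have hL : ∀ z z₁ z₂ z₃ : ℂ,
      L (z, z₁, z₂, z₃) = (b₁ * z₁ + b₂ * z₂ + b₃ * z₃ + a * z).re := by
    intro z z₁ z₂ z₃
    have : ((z, z₁, z₂, z₃) : ℂ × ℂ × ℂ × ℂ) = (0, z₁, z₂, z₃) + (z, 0) := by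
      simp
    rw [this, map_add, hLq, ha]
    simp
  have e₀ := (hS _ (S.smul_mem a hp)).integral_exp
  have e₁ := (hS _ hqS).integral_exp
  have e₂ := (hS _ (S.add_mem hqS (S.smul_mem a hp))).integral_exp
  have hnorm : ∫ x, ‖(q + a • p).2 x‖ ^ 2 ∂ρ =
      ∫ x, ‖(a • p).2 x‖ ^ 2 ∂ρ + ∫ x, ‖q.2 x‖ ^ 2 ∂ρ := by
    have := integral_norm_add_smul_sq (hS _ hqS).memLp (hS _ hp).memLp a
    simp only [Prod.snd_add, Prod.smul_snd, Pi.add_apply, Pi.smul_apply, smul_eq_mul] at this ⊢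
    rw [this]
    have hz : ∫ x, q.2 x * conj (p.2 x) ∂ρ = 0 := by
      have i₁ := memLp_two_mul_conj (hS _ hq₁).memLp (hS _ hp).memLp
      have i₂ := memLp_two_mul_conj (hS _ hq₂).memLp (hS _ hp).memLp
      have i₃ := memLp_two_mul_conj (hS _ hq₃).memLp (hS _ hp).memLp
      simp only [hq, Prod.snd_add, Prod.smul_snd, Pi.add_apply, Pi.smul_apply, smul_eq_mul,
        add_mul, mul_assoc]
      have i₁₂ : Integrable (fun x => b₁ * (q₁.2 x * conj (p.2 x)) + b₂ * (q₂.2 x * conj (p.2 x))) ρ :=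
        (i₁.const_mul _).add (i₂.const_mul _)
      rw [integral_add i₁₂ (i₃.const_mul _),
        integral_add (i₁.const_mul _) (i₂.const_mul _), integral_const_mul, integral_const_mul,
        integral_const_mul, h₁, h₂, h₃]
      simp
    rw [hz]
    simp only [norm_mul, mul_pow]
    rw [integral_const_mul]
    simp
    ring
  rw [charFunDual_apply, charFunDual_apply, charFunDual_apply,
    integral_map (mp.prodMk mq) (by fun_prop), integral_map mp (by fun_prop),
    integral_map mq (by fun_prop)]
  simp only [ContinuousLinearMap.comp_apply, ContinuousLinearMap.inl_apply,
    ContinuousLinearMap.inr_apply]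
  simp only [hL, Prod.fst_zero, Prod.snd_zero, mul_zero, add_zero, zero_add]
  have e₀' : ∫ ω, Complex.exp (((a * p.1 ω).re : ℂ) * Complex.I) ∂P = _ := e₀
  have e₁' : ∫ ω, Complex.exp (((b₁ * q₁.1 ω + b₂ * q₂.1 ω + b₃ * q₃.1 ω).re : ℂ)
    * Complex.I) ∂P = _ := e₁
  have e₂' : ∫ ω, Complex.exp (((b₁ * q₁.1 ω + b₂ * q₂.1 ω + b₃ * q₃.1 ω + a * p.1 ω).re : ℂ)
    * Complex.I) ∂P = _ := e₂
  rw [e₀', e₁', e₂', hnorm, ← Complex.exp_add]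
  congr 1
  push_cast
  ring

end Isonormal

/-! ### Wick formula with a nonlinear factor -/

section WickFormula

/-- Functions of a complex variable having the phase of `z⁻¹` and normalized so that
`z * N z` has mean one under the standard complex Gaussian law. -/
structure IsDualFactor (N : ℂ → ℂ) : Prop where
  measurable : Measurable N
  phase : ∀ c z : ℂ, ‖c‖ = 1 → N (c * z) = conj c * N z
  norm_le : ∀ z : ℂ, ‖N z‖ ≤ ‖z‖ ^ (-1 : ℝ) + ‖z‖ ^ (1 : ℝ)
  integral_mul : ∫ z, N z * z ∂stdComplexGaussian = 1

theorem isDualFactor_conj : IsDualFactor (fun z => conj z) where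
  measurable := by fun_prop
  phase := fun c z _ => by simp
  norm_le := fun z => by
    have := Real.rpow_nonneg (norm_nonneg z) (-1)
    simpa using this
  integral_mul := by
    have : ∀ z : ℂ, conj z * z = ((‖z‖ ^ 2 : ℝ) : ℂ) := by
      intro z; rw [Complex.conj_mul']; push_cast; rfl
    simp only [this]
    rw [integral_complex_ofReal, integral_norm_sq_stdComplexGaussian]
    simp

theorem isDualFactor_inv : IsDualFactor (fun z => z⁻¹) where
  measurable := by fun_prop
  phase := fun c z hc => by
    have hc0 : c ≠ 0 := by rintro rfl; simp at hc
    rw [mul_inv, Complex.inv_def c, Complex.normSq_eq_norm_sq, hc]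
    simp
  norm_le := fun z => by
    rw [norm_inv, Real.rpow_neg_one, Real.rpow_one]
    linarith [norm_nonneg z]
  integral_mul := by
    have : (fun z : ℂ => z⁻¹ * z) =ᵐ[stdComplexGaussian] fun _ => 1 := by
      have h : ∀ᵐ z ∂stdComplexGaussian, z ≠ 0 := by
        rw [ae_iff]; simpa using stdComplexGaussian_singleton 0
      filter_upwards [h] with z hz using inv_mul_cancel₀ hz
    rw [integral_congr_ae this]
    simp

variable {N : ℂ → ℂ}

theorem IsDualFactor.integrable_mul (hN : IsDualFactor N) {g : ℂ → ℂ} (hg : Measurable g)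
    {q : ℝ} (hq : 0 ≤ q) (hgq : ∀ z, ‖g z‖ ≤ ‖z‖ ^ q) :
    Integrable (fun z => N z * g z) stdComplexGaussian := by
  have h1 := integrable_norm_rpow_stdComplexGaussian (q := -1 + q) (by linarith)
  have h2 := integrable_norm_rpow_stdComplexGaussian (q := 1 + q) (by linarith)
  refine Integrable.mono' (h1.add h2) (hN.measurable.mul hg).aestronglyMeasurable ?_
  have h : ∀ᵐ z ∂stdComplexGaussian, z ≠ 0 := by
    rw [ae_iff]; simpa using stdComplexGaussian_singleton 0
  filter_upwards [h] with z hz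
  have hz' : 0 < ‖z‖ := norm_pos_iff.2 hz
  rw [norm_mul, Pi.add_apply, Real.rpow_add hz', Real.rpow_add hz', ← add_mul]
  exact mul_le_mul (hN.norm_le z) (hgq z) (norm_nonneg _) (by positivity)

theorem IsDualFactor.integrable (hN : IsDualFactor N) : Integrable N stdComplexGaussian := by
  have := hN.integrable_mul (g := fun _ => 1) measurable_const le_rfl (fun z => by simp)
  simpa using this

theorem IsDualFactor.integral_eq_zero (hN : IsDualFactor N) :
    ∫ z, N z ∂stdComplexGaussian = 0 :=
  integral_eq_zero_of_rotation (c := -1) (d := -1) (by simp) (by norm_num)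
    fun z => by rw [hN.phase _ _ (by simp)]; simp

theorem IsDualFactor.integral_mul_conj (hN : IsDualFactor N) :
    ∫ z, N z * conj z ∂stdComplexGaussian = 0 :=
  -- The integrand turns by `(conj c)²`, so `c = -1` would give no information and a quarter turn is
  -- used.
  integral_eq_zero_of_rotation (c := Complex.I) (d := -1) (by simp) (by norm_num)
    fun z => by
      rw [hN.phase _ _ (by simp)]
      simp only [map_mul, Complex.conj_I]
      linear_combination N z * conj z * Complex.I_sq

theorem IsDualFactor.integral_mul_mul_conj (hN : IsDualFactor N) :
    ∫ z, N z * (z * conj z) ∂stdComplexGaussian = 0 :=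
  integral_eq_zero_of_rotation (c := -1) (d := -1) (by simp) (by norm_num)
    fun z => by rw [hN.phase _ _ (by simp)]; simp

variable {Ω E : Type*} [MeasurableSpace Ω] [MeasurableSpace E]
  {P : Measure Ω} {ρ : Measure E}
  {S : Submodule ℂ ((Ω → ℂ) × (E → ℂ))}

theorem integrable_mul_and_integral_of_indepFun {X : Ω → ℂ} {Y : Ω → ℂ × ℂ × ℂ}
    (hX : AEMeasurable X P) (hmap : P.map X = stdComplexGaussian) (hXY : IndepFun X Y P)
    {φ : ℂ → ℂ} {ψ : ℂ × ℂ × ℂ → ℂ} (hφ : Measurable φ) (hψ : Measurable ψ)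
    (hφi : Integrable φ stdComplexGaussian) (hψi : Integrable (fun ω => ψ (Y ω)) P) :
    Integrable (fun ω => φ (X ω) * ψ (Y ω)) P ∧
      ∫ ω, φ (X ω) * ψ (Y ω) ∂P =
        (∫ z, φ z ∂stdComplexGaussian) * ∫ ω, ψ (Y ω) ∂P := by
  have hind : IndepFun (fun ω => φ (X ω)) (fun ω => ψ (Y ω)) P := hXY.comp hφ hψ
  rw [← hmap] at hφi
  have hi : Integrable (fun ω => φ (X ω)) P := hφi.comp_aemeasurable hX
  refine ⟨hind.integrable_mul hi hψi, ?_⟩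
  rw [← hmap, integral_map hX hφ.aestronglyMeasurable]
  exact hind.integral_mul_eq_mul_integral hi.aestronglyMeasurable hψi.aestronglyMeasurable

/-- Split `u` and `v` into their projections on `z` and residuals `u'`, `v'`. The triple `(w, u',
v')` is independent of `z`, so each of the four terms is a function of `z` times a function of the
triple. By rotation only the term with `N(z) · z` survives, and its mean is normalized to one; the
result does not depend on `N`. -/
theorem IsIsonormal.dualFactor_wick [IsProbabilityMeasure P] (hS : IsIsonormal P ρ S) (hN : IsDualFactor N)
    {z w u v : (Ω → ℂ) × (E → ℂ)} (hz : z ∈ S) (hw : w ∈ S) (hu : u ∈ S) (hv : v ∈ S)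
    (hz1 : ∫ x, ‖z.2 x‖ ^ 2 ∂ρ = 1) (hwz : ∫ x, w.2 x * conj (z.2 x) ∂ρ = 0) :
    Integrable (fun ω => N (z.1 ω) * w.1 ω * (v.1 ω * conj (u.1 ω))) P ∧
    ∫ ω, N (z.1 ω) * w.1 ω * (v.1 ω * conj (u.1 ω)) ∂P =
      (∫ x, v.2 x * conj (z.2 x) ∂ρ) * ∫ x, w.2 x * conj (u.2 x) ∂ρ := by
  set a := ∫ x, u.2 x * conj (z.2 x) ∂ρ with ha
  set c := ∫ x, v.2 x * conj (z.2 x) ∂ρ with hc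
  set u' := u + (-a) • z with hu'
  set v' := v + (-c) • z with hv'
  have hu'S : u' ∈ S := S.add_mem hu (S.smul_mem _ hz)
  have hv'S : v' ∈ S := S.add_mem hv (S.smul_mem _ hz)
  have hzz : ∫ x, z.2 x * conj (z.2 x) ∂ρ = 1 := by
    simp only [Complex.mul_conj']
    exact_mod_cast congrArg (fun t : ℝ => (t : ℂ)) hz1
  have orth : ∀ {y : (Ω → ℂ) × (E → ℂ)}, y ∈ S →
      ∫ x, (y + (-(∫ x, y.2 x * conj (z.2 x) ∂ρ)) • z).2 x * conj (z.2 x) ∂ρ = 0 := by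
    intro y hy
    have i1 := memLp_two_mul_conj (hS _ hy).memLp (hS _ hz).memLp
    have i2 := memLp_two_mul_conj (hS _ hz).memLp (hS _ hz).memLp
    simp only [Prod.snd_add, Prod.smul_snd, Pi.add_apply, Pi.smul_apply, smul_eq_mul, add_mul,
      mul_assoc]
    rw [integral_add i1 (i2.const_mul _), integral_const_mul, hzz]
    ring
  have hind := hS.indepFun hz hw hu'S hv'S hwz (orth hu) (orth hv)
  have hmap := hS.map_eq_std hz hz1
  have mz := (hS _ hz).aemeasurable
  have Lw : ∀ q : ENNReal, q ≠ ⊤ → MemLp w.1 q P := fun q hq => hS.memLp hw hq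
  have Lu : ∀ q : ENNReal, q ≠ ⊤ → MemLp (fun ω => conj (u'.1 ω)) q P :=
    fun q hq => (hS.memLp hu'S hq).star
  have Lv : ∀ q : ENNReal, q ≠ ⊤ → MemLp v'.1 q P := fun q hq => hS.memLp hv'S hq
  have iw : Integrable w.1 P := memLp_one_iff_integrable.1 (Lw 1 (by simp))
  have iwu : Integrable (fun ω => w.1 ω * conj (u'.1 ω)) P :=
    (Lw 2 (by simp)).integrable_mul (Lu 2 (by simp))
  have iwv : Integrable (fun ω => w.1 ω * v'.1 ω) P :=
    (Lw 2 (by simp)).integrable_mul (Lv 2 (by simp))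
  have iwuv : Integrable (fun ω => w.1 ω * (v'.1 ω * conj (u'.1 ω))) P := by
    have : MemLp (fun ω => v'.1 ω * conj (u'.1 ω)) 2 P :=
      haveI : ENNReal.HolderTriple 4 4 2 := ⟨by
        have h4 : (4 : ENNReal)⁻¹ = 2⁻¹ * 2⁻¹ := by
          rw [← ENNReal.mul_inv (by simp) (by simp)]; norm_num
        rw [h4, ← mul_add, ENNReal.inv_two_add_inv_two, mul_one]⟩
      (Lu 4 (by simp)).mul (Lv 4 (by simp))
    exact (Lw 2 (by simp)).integrable_mul this
  have T1 := integrable_mul_and_integral_of_indepFun mz hmap hind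
    (φ := fun z => N z * (z * conj z)) (ψ := fun y => y.1)
    (hN.measurable.mul (by fun_prop)) (by fun_prop)
    (hN.integrable_mul (by fun_prop) (q := 2) (by norm_num)
      (fun z => by rw [norm_mul, RCLike.norm_conj, Real.rpow_two, sq])) iw
  have T2 := integrable_mul_and_integral_of_indepFun mz hmap hind
    (φ := fun z => N z * z) (ψ := fun y => y.1 * conj y.2.1)
    (hN.measurable.mul (by fun_prop)) (by fun_prop)
    (hN.integrable_mul (by fun_prop) (q := 1) (by norm_num)
      (fun z => by rw [Real.rpow_one])) iwu
  have T3 := integrable_mul_and_integral_of_indepFun mz hmap hind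
    (φ := fun z => N z * conj z) (ψ := fun y => y.1 * y.2.2)
    (hN.measurable.mul (by fun_prop)) (by fun_prop)
    (hN.integrable_mul (by fun_prop) (q := 1) (by norm_num)
      (fun z => by rw [Real.rpow_one, RCLike.norm_conj])) iwv
  have T4 := integrable_mul_and_integral_of_indepFun mz hmap hind
    (φ := N) (ψ := fun y => y.1 * (y.2.2 * conj y.2.1))
    hN.measurable (by fun_prop) hN.integrable iwuv
  rw [hN.integral_mul_mul_conj, zero_mul] at T1
  rw [hN.integral_mul, one_mul] at T2
  rw [hN.integral_mul_conj, zero_mul] at T3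
  rw [hN.integral_eq_zero, zero_mul] at T4
  have expand : ∀ ω, N (z.1 ω) * w.1 ω * (v.1 ω * conj (u.1 ω)) =
      ((c * conj a) * (N (z.1 ω) * (z.1 ω * conj (z.1 ω)) * w.1 ω) +
        c * (N (z.1 ω) * z.1 ω * (w.1 ω * conj (u'.1 ω)))) +
      (conj a * (N (z.1 ω) * conj (z.1 ω) * (w.1 ω * v'.1 ω)) +
        N (z.1 ω) * (w.1 ω * (v'.1 ω * conj (u'.1 ω)))) := by
    intro ω
    have e1 : v.1 ω = c * z.1 ω + v'.1 ω := by simp [hv']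
    have e2 : u.1 ω = a * z.1 ω + u'.1 ω := by simp [hu']
    rw [e1, e2, map_add, map_mul]
    ring
  simp only [expand]
  have I12 := (T1.1.const_mul (c * conj a)).add (T2.1.const_mul c)
  have I34 := (T3.1.const_mul (conj a)).add T4.1
  refine ⟨I12.add I34, ?_⟩
  have hwu : ∫ ω, w.1 ω * conj (u'.1 ω) ∂P = ∫ x, w.2 x * conj (u.2 x) ∂ρ := by
    rw [hS.integral_mul_conj hw hu'S]
    have i1 := memLp_two_mul_conj (hS _ hw).memLp (hS _ hu).memLp
    have i2 := memLp_two_mul_conj (hS _ hw).memLp (hS _ hz).memLp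
    have : ∀ x, w.2 x * conj (u'.2 x) =
        w.2 x * conj (u.2 x) + conj (-a) * (w.2 x * conj (z.2 x)) := by
      intro x; simp [hu']; ring
    simp only [this]
    rw [integral_add i1 (i2.const_mul _), integral_const_mul, hwz]
    simp
  refine (integral_add I12 I34).trans ?_
  erw [integral_add (T1.1.const_mul (c * conj a)) (T2.1.const_mul c),
    integral_add (T3.1.const_mul (conj a)) T4.1]
  rw [integral_const_mul, integral_const_mul, integral_const_mul, T1.2, T2.2, T3.2, T4.2, hwu]
  ring

theorem im_mul_im (a b : ℂ) : a.im * b.im = (a * conj b - a * b).re / 2 := by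
  simp

/-- Writing `Im a · Im b = Re(a · conj b - a · b) / 2` gives two Wick integrals that differ by
exchanging `u` and `v`. -/
theorem IsIsonormal.integral_im_mul_im [IsProbabilityMeasure P] (hS : IsIsonormal P ρ S) (hN : IsDualFactor N)
    {z w u v : (Ω → ℂ) × (E → ℂ)} (hz : z ∈ S) (hw : w ∈ S) (hu : u ∈ S) (hv : v ∈ S)
    (hz1 : ∫ x, ‖z.2 x‖ ^ 2 ∂ρ = 1) (hwz : ∫ x, w.2 x * conj (z.2 x) ∂ρ = 0) :
    ∫ ω, (N (z.1 ω) * w.1 ω).im * (v.1 ω * conj (u.1 ω)).im ∂P =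
      ((∫ x, u.2 x * conj (z.2 x) ∂ρ) * (∫ x, w.2 x * conj (v.2 x) ∂ρ) -
        (∫ x, v.2 x * conj (z.2 x) ∂ρ) * ∫ x, w.2 x * conj (u.2 x) ∂ρ).re / 2 := by
  have h1 := hS.dualFactor_wick hN hz hw hu hv hz1 hwz
  have h2 := hS.dualFactor_wick hN hz hw hv hu hz1 hwz
  simp only [im_mul_im, map_mul, Complex.conj_conj]
  rw [integral_div]
  have e : ∀ ω, N (z.1 ω) * w.1 ω * (conj (v.1 ω) * u.1 ω) =
      N (z.1 ω) * w.1 ω * (u.1 ω * conj (v.1 ω)) := fun ω => by ring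
  simp only [e]
  rw [← h1.2, ← h2.2, ← integral_sub h2.1 h1.1]
  congr 1
  exact integral_re (h2.1.sub h1.1)

end WickFormula

/-! ### Linear forms of complex Gaussian vectors -/

section GaussianVector

theorem measurable_sum_const_mul {m : ℕ} (b : Fin m → ℂ) :
    Measurable fun v : Fin m → ℂ => ∑ k, b k * v k :=
  (continuous_finsetSum _ fun k _ =>
    continuous_const.mul (continuous_apply k)).measurable

theorem integral_exp_linear_pi_stdComplexGaussian {m : ℕ} (b : Fin m → ℂ) :
    ∫ v, Complex.exp ((∑ k, b k * v k).re * Complex.I)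
      ∂(Measure.pi fun _ : Fin m => stdComplexGaussian) =
      Complex.exp (-(∑ k, ‖b k‖ ^ 2 : ℝ) / 4) := by
  have h : ∀ v : Fin m → ℂ, Complex.exp ((∑ k, b k * v k).re * Complex.I) =
      ∏ k, Complex.exp ((inner ℝ (v k) (conj (b k)) : ℝ) * Complex.I) := by
    intro v
    rw [← Complex.exp_sum, ← Finset.sum_mul, Complex.re_sum]
    push_cast
    congr 2
    refine Finset.sum_congr rfl fun k _ => ?_
    rw [Complex.inner]
    simp
  simp only [h]
  rw [integral_fintype_prod_eq_prod
    (f := fun k z => Complex.exp ((inner ℝ z (conj (b k)) : ℝ) * Complex.I))]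
  simp only [← charFun_apply (E := ℂ), charFun_stdComplexGaussian]
  rw [← Complex.exp_sum]
  congr 1
  push_cast
  rw [neg_div, Finset.sum_div, ← Finset.sum_neg_distrib]
  refine Finset.sum_congr rfl fun k _ => ?_
  rw [RCLike.norm_conj]
  ring

variable {Ω : Type*} [MeasurableSpace Ω] {P : Measure Ω}

/-- A linear form in i.i.d. standard variables has a characteristic function that depends on its
coefficients only through the sum of their squared moduli; `σ` is the root of that sum. -/
theorem IsComplexGaussianVector.exists_map_linear_eq {n : ℕ} {X : Ω → Fin n → ℂ}
    (hX : IsComplexGaussianVector X P) (c : Fin n → ℂ) :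
    ∃ σ : ℝ, 0 ≤ σ ∧ P.map (fun ω => ∑ j, c j * X ω j) =
      stdComplexGaussian.map (fun z => σ • z) := by
  obtain ⟨hm, m, A, hA⟩ := hX
  set b : Fin m → ℂ := c ᵥ* A with hb
  have hlin : ∀ v : Fin m → ℂ, ∑ j, c j * (A *ᵥ v) j = ∑ k, b k * v k := by
    intro v
    exact Matrix.dotProduct_mulVec c A v
  have hAm : Measurable (fun v : Fin m → ℂ => A *ᵥ v) :=
    (Continuous.matrix_mulVec continuous_const continuous_id).measurable
  have hmap : P.map (fun ω => ∑ j, c j * X ω j) =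
      (Measure.pi fun _ : Fin m => stdComplexGaussian).map (fun v => ∑ k, b k * v k) := by
    have e1 := AEMeasurable.map_map_of_aemeasurable
      (g := fun x : Fin n → ℂ => ∑ j, c j * x j) (f := X) (μ := P)
      (measurable_sum_const_mul c).aemeasurable hm
    have e2 := Measure.map_map (μ := Measure.pi fun _ : Fin m => stdComplexGaussian)
      (g := fun x : Fin n → ℂ => ∑ j, c j * x j) (measurable_sum_const_mul c) hAm
    rw [hA, e2] at e1
    rw [Function.comp_def] at e1
    simp only [hlin, Function.comp_def] at e1
    exact e1.symm
  refine ⟨Real.sqrt (∑ k, ‖b k‖ ^ 2), Real.sqrt_nonneg _, ?_⟩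
  rw [hmap]
  have : IsProbabilityMeasure ((Measure.pi fun _ : Fin m => stdComplexGaussian).map
      (fun v => ∑ k, b k * v k)) := 
    Measure.isProbabilityMeasure_map (measurable_sum_const_mul b).aemeasurable
  refine Measure.ext_of_charFun ?_
  ext t
  rw [charFun_map_smul, charFun_stdComplexGaussian, norm_smul, mul_pow, Real.norm_eq_abs, sq_abs,
    Real.sq_sqrt (by positivity), charFun_apply,
    integral_map (measurable_sum_const_mul b).aemeasurable (by fun_prop)]
  have := integral_exp_linear_pi_stdComplexGaussian (fun k => conj t * b k)
  have e : ∀ v : Fin m → ℂ, inner ℝ (∑ k, b k * v k) t = (∑ k, conj t * b k * v k).re := by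
    intro v
    simp only [mul_assoc, ← Finset.mul_sum]
    rw [Complex.inner, ← Complex.conj_re]
    simp
  simp only [e, this, norm_mul, RCLike.norm_conj, mul_pow, ← Finset.mul_sum]
  rw [mul_comm]

theorem integral_exp_of_map_eq {Y : Ω → ℂ} (hY : AEMeasurable Y P) {σ : ℝ}
    (h : P.map Y = stdComplexGaussian.map (fun z => σ • z)) :
    MemLp Y 2 P ∧ ∫ ω, Complex.exp ((Y ω).re * Complex.I) ∂P =
      Complex.exp (-(∫ ω, ‖Y ω‖ ^ 2 ∂P : ℝ) / 4) := by
  constructor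
  · have h2 : MemLp (fun z : ℂ => z) 2 (P.map Y) := by
      rw [h, memLp_map_measure_iff (by fun_prop) (by fun_prop)]
      have := (memLp_id_stdComplexGaussian (q := 2) (by simp)).const_smul σ
      exact this
    exact (memLp_map_measure_iff (by fun_prop) hY).1 h2
  · have e1 : ∫ ω, Complex.exp ((Y ω).re * Complex.I) ∂P = charFun (P.map Y) 1 := by
      rw [charFun_apply, integral_map hY (by fun_prop)]
      simp [Complex.inner]
    have e2 : ∫ ω, ‖Y ω‖ ^ 2 ∂P = σ ^ 2 := by
      rw [← integral_map (f := fun z : ℂ => ‖z‖ ^ 2) hY (by fun_prop), h,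
        integral_map (by fun_prop) (by fun_prop)]
      simp only [norm_smul, mul_pow, Real.norm_eq_abs, sq_abs]
      rw [integral_const_mul, integral_norm_sq_stdComplexGaussian, mul_one]
    rw [e1, e2, h, charFun_map_smul, charFun_stdComplexGaussian]
    simp

end GaussianVector

/-! ### The span of a stationary process and its spectral representation -/

section StationaryProcess

theorem integral_norm_sum_sq {α : Type*} [MeasurableSpace α] {μ : Measure α} {n : ℕ}
    (c : Fin n → ℂ) (x : Fin n → α → ℂ) (hx : ∀ i, MemLp (x i) 2 μ) :
    ((∫ a, ‖∑ i, c i * x i a‖ ^ 2 ∂μ : ℝ) : ℂ) =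
      ∑ i, ∑ j, c i * conj (c j) * ∫ a, x i a * conj (x j a) ∂μ := by
  rw [← integral_complex_ofReal]
  have h : ∀ a, ((‖∑ i, c i * x i a‖ ^ 2 : ℝ) : ℂ) =
      ∑ i, ∑ j, c i * conj (c j) * (x i a * conj (x j a)) := by
    intro a
    push_cast
    rw [← Complex.mul_conj', map_sum, Finset.sum_mul_sum]
    refine Finset.sum_congr rfl fun i _ => Finset.sum_congr rfl fun j _ => ?_
    rw [map_mul]; ring
  have hi : ∀ i j, Integrable (fun a => c i * conj (c j) * (x i a * conj (x j a))) μ :=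
    fun i j => (memLp_two_mul_conj (hx i) (hx j)).const_mul _
  simp only [h]
  rw [integral_finsetSum _ fun i _ => integrable_finsetSum _ fun j _ => hi i j]
  refine Finset.sum_congr rfl fun i _ => ?_
  rw [integral_finsetSum _ fun j _ => hi i j]
  exact Finset.sum_congr rfl fun j _ => integral_const_mul _ _

/-- The spectral representative of the value of the process at time `t`. -/
noncomputable def spectralExp (t l : ℝ) : ℂ := Complex.exp (-Complex.I * t * l)

theorem norm_spectralExp (t l : ℝ) : ‖spectralExp t l‖ = 1 := by
  rw [spectralExp, Complex.norm_exp]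
  simp

theorem continuous_spectralExp (t : ℝ) : Continuous (spectralExp t) := by
  unfold spectralExp; fun_prop

theorem conj_spectralExp (t l : ℝ) : conj (spectralExp t l) = spectralExp (-t) l := by
  rw [spectralExp, spectralExp, ← Complex.exp_conj]
  simp

theorem spectralExp_add (s t l : ℝ) :
    spectralExp (s + t) l = spectralExp s l * spectralExp t l := by
  rw [spectralExp, spectralExp, spectralExp, ← Complex.exp_add]
  congr 1; push_cast; ring

variable {Ω : Type*} [MeasurableSpace Ω] {P : Measure Ω} {f : ℝ → Ω → ℂ}

/-- The linear span of a process, each variable paired with its spectral representative. -/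
def processSpan (f : ℝ → Ω → ℂ) : Submodule ℂ ((Ω → ℂ) × (ℝ → ℂ)) :=
  Submodule.span ℂ (Set.range fun t => (f t, spectralExp t))

theorem IsGSP.aemeasurable (hf : IsGSP f P) (t : ℝ) : AEMeasurable (f t) P := by
  have := (hf.gaussian 1 (fun _ => t)).1
  exact (measurable_pi_apply 0).comp_aemeasurable this

theorem IsGSP.memLp (hf : IsGSP f P) (t : ℝ) : MemLp (f t) 2 P := by
  obtain ⟨σ, _, h⟩ := (hf.gaussian 1 (fun _ => t)).exists_map_linear_eq (fun _ => 1)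
  have := integral_exp_of_map_eq (by simpa using hf.aemeasurable t) h
  simpa using this.1

theorem IsGSP.integral_mul_conj (hf : IsGSP f P) (s t : ℝ) :
    ∫ ω, f s ω * conj (f t ω) ∂P = covarianceKernel f P (s - t) := by
  have h := hf.stationary 2 ![s - t, 0] t
  have m : ∀ u : Fin 2 → ℝ, AEMeasurable (fun ω i => f (u i) ω) P :=
    fun u => aemeasurable_pi_lambda _ fun i => hf.aemeasurable (u i)
  have e : ∀ u : Fin 2 → ℝ, ∫ ω, f (u 0) ω * conj (f (u 1) ω) ∂P =
      ∫ x : Fin 2 → ℂ, x 0 * conj (x 1) ∂(P.map fun ω i => f (u i) ω) := by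
    intro u
    rw [integral_map (m u) (by fun_prop)]
  have e1 := e (fun i => ![s - t, 0] i + t)
  rw [h, ← e] at e1
  simpa [covarianceKernel] using e1

theorem memLp_spectralExp {ρ : Measure ℝ} [IsProbabilityMeasure ρ] (t : ℝ) :
    MemLp (spectralExp t) 2 ρ :=
  MemLp.of_bound (continuous_spectralExp t).aestronglyMeasurable 1
    (Filter.Eventually.of_forall fun l => (norm_spectralExp t l).le)

/-- Gaussianity gives the characteristic function in terms of the variance of a linear combination.
Stationarity and the spectral formula identify that variance with the `L²(ρ)` norm of the same
combination of exponentials. -/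
theorem IsGSP.isIsonormal_processSpan (hf : IsGSP f P) {r : ℝ → ℂ} {ρ : Measure ℝ}
    (hρ : IsSpectralMeasure r ρ) (hr : ∀ t, covarianceKernel f P t = r t) :
    IsIsonormal P ρ (processSpan f) := by
  have := hρ.1
  intro p hp
  obtain ⟨n, c, g, rfl⟩ := Submodule.mem_span_set'.1 hp
  have hg : ∀ i, ∃ t, ((f t, spectralExp t) : (Ω → ℂ) × (ℝ → ℂ)) = g i := fun i => (g i).2
  choose t ht using hg
  have e1 : (∑ i, c i • (g i : (Ω → ℂ) × (ℝ → ℂ))).1 = fun ω => ∑ i, c i * f (t i) ω := by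
    ext ω
    simp [← ht, Prod.fst_sum]
  have e2 : (∑ i, c i • (g i : (Ω → ℂ) × (ℝ → ℂ))).2 =
      fun l => ∑ i, c i * spectralExp (t i) l := by
    ext l
    simp [← ht, Prod.snd_sum]
  have hm : AEMeasurable (fun ω => ∑ i, c i * f (t i) ω) P :=
    Finset.aemeasurable_fun_sum _ fun i _ => (hf.aemeasurable (t i)).const_mul _
  refine ⟨e1 ▸ hm, e2 ▸ memLp_finsetSum _ fun i _ => (memLp_spectralExp _).const_mul _, ?_⟩
  obtain ⟨σ, _, h⟩ := (hf.gaussian n t).exists_map_linear_eq c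
  rw [e1, e2, (integral_exp_of_map_eq hm h).2]
  congr 3
  apply congrArg
  have : ((∫ ω, ‖∑ i, c i * f (t i) ω‖ ^ 2 ∂P : ℝ) : ℂ) =
      ((∫ l, ‖∑ i, c i * spectralExp (t i) l‖ ^ 2 ∂ρ : ℝ) : ℂ) := by
    rw [integral_norm_sum_sq c _ fun i => hf.memLp (t i),
      integral_norm_sum_sq c _ fun i => memLp_spectralExp (t i)]
    refine Finset.sum_congr rfl fun i _ => Finset.sum_congr rfl fun j _ => ?_
    rw [hf.integral_mul_conj, hr, hρ.2]
    congr 2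
    ext l
    rw [conj_spectralExp, ← spectralExp_add, spectralExp]
    push_cast
    ring_nf
  exact_mod_cast this

end StationaryProcess

/-! ### Stability of the Gaussian family under dominated limits -/

section Closure

variable {Ω E : Type*} [MeasurableSpace Ω] [MeasurableSpace E]

/-- Limits of sequences in `S` which converge almost surely in the first component and
boundedly in `L²(ρ)` in the second one. -/
def dominatedClosure (P : Measure Ω) (ρ : Measure E) (S : Submodule ℂ ((Ω → ℂ) × (E → ℂ))) :
    Submodule ℂ ((Ω → ℂ) × (E → ℂ)) where
  carrier := {p | ∃ u : ℕ → (Ω → ℂ) × (E → ℂ), (∀ n, u n ∈ S) ∧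
    (∀ᵐ ω ∂P, Filter.Tendsto (fun n => (u n).1 ω) Filter.atTop (nhds (p.1 ω))) ∧
    (∀ x, Filter.Tendsto (fun n => (u n).2 x) Filter.atTop (nhds (p.2 x))) ∧
    ∃ G : E → ℝ, MemLp G 2 ρ ∧ ∀ n x, ‖(u n).2 x‖ ≤ G x}
  add_mem' := by
    rintro p q ⟨u, hu, hu1, hu2, G, hG, hGu⟩ ⟨v, hv, hv1, hv2, H, hH, hHv⟩
    refine ⟨fun n => u n + v n, fun n => S.add_mem (hu n) (hv n), ?_,
      fun x => (hu2 x).add (hv2 x), fun x => G x + H x, hG.add hH,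
      fun n x => (norm_add_le _ _).trans (add_le_add (hGu n x) (hHv n x))⟩
    filter_upwards [hu1, hv1] with ω h1 h2 using h1.add h2
  zero_mem' := ⟨fun _ => 0, fun _ => S.zero_mem, by simp, by simp, fun _ => 0,
    MemLp.zero', by simp⟩
  smul_mem' := by
    rintro c p ⟨u, hu, hu1, hu2, G, hG, hGu⟩
    refine ⟨fun n => c • u n, fun n => S.smul_mem c (hu n), ?_,
      fun x => (hu2 x).const_mul c, fun x => ‖c‖ * G x, hG.const_mul _, fun n x => ?_⟩
    · filter_upwards [hu1] with ω h1 using h1.const_mul c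
    · simpa using mul_le_mul_of_nonneg_left (hGu n x) (norm_nonneg c)

variable {P : Measure Ω} {ρ : Measure E} {S : Submodule ℂ ((Ω → ℂ) × (E → ℂ))}

theorem IsIsonormal.le_dominatedClosure (hS : IsIsonormal P ρ S) :
    S ≤ dominatedClosure P ρ S := fun p hp =>
  ⟨fun _ => p, fun _ => hp, by simp, by simp, fun x => ‖p.2 x‖, (hS p hp).memLp.norm, by simp⟩

/-- Both sides of the characteristic function identity pass to the limit by dominated convergence:
the exponentials are bounded by one, and the squared representatives by `G²`. -/
theorem IsIsonormal.dominatedClosure [IsProbabilityMeasure P] (hS : IsIsonormal P ρ S) :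
    IsIsonormal P ρ (dominatedClosure P ρ S) := by
  rintro p ⟨u, hu, hu1, hu2, G, hG, hGu⟩
  have hm : AEMeasurable p.1 P :=
    aemeasurable_of_tendsto_metrizable_ae Filter.atTop (fun n => (hS _ (hu n)).aemeasurable) hu1
  have hm2 : AEStronglyMeasurable p.2 ρ :=
    aestronglyMeasurable_of_tendsto_ae Filter.atTop
      (fun n => (hS _ (hu n)).memLp.aestronglyMeasurable) (Filter.Eventually.of_forall hu2)
  have hp2 : ∀ x, ‖p.2 x‖ ≤ G x := fun x =>
    le_of_tendsto (hu2 x).norm (Filter.Eventually.of_forall fun n => hGu n x)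
  refine ⟨hm, hG.mono' hm2 (Filter.Eventually.of_forall hp2), ?_⟩
  have L1 : Filter.Tendsto (fun n => ∫ ω, Complex.exp (((u n).1 ω).re * Complex.I) ∂P)
      Filter.atTop (nhds (∫ ω, Complex.exp ((p.1 ω).re * Complex.I) ∂P)) := by
    refine tendsto_integral_of_dominated_convergence (fun _ => 1) (fun n => ?_)
      (integrable_const _) (fun n => Filter.Eventually.of_forall fun ω => ?_) ?_
    · have := (hS _ (hu n)).aemeasurable
      exact (by fun_prop : AEMeasurable _ P).aestronglyMeasurable
    · rw [Complex.norm_exp_ofReal_mul_I]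
    · filter_upwards [hu1] with ω hω
      have hc : Continuous fun z : ℂ => Complex.exp (z.re * Complex.I) := by fun_prop
      exact (hc.tendsto _).comp hω
  have L2 : Filter.Tendsto (fun n => ∫ x, ‖(u n).2 x‖ ^ 2 ∂ρ)
      Filter.atTop (nhds (∫ x, ‖p.2 x‖ ^ 2 ∂ρ)) := by
    refine tendsto_integral_of_dominated_convergence (fun x => G x ^ 2) (fun n => ?_)
      hG.integrable_sq (fun n => Filter.Eventually.of_forall fun x => ?_)
      (Filter.Eventually.of_forall fun x => (hu2 x).norm.pow 2)
    · exact (hS _ (hu n)).memLp.aestronglyMeasurable.norm.pow 2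
    · rw [norm_pow, norm_norm]
      exact pow_le_pow_left₀ (norm_nonneg _) (hGu n x) 2
  have L3 : Filter.Tendsto
      (fun n => Complex.exp (-(∫ x, ‖(u n).2 x‖ ^ 2 ∂ρ : ℝ) / 4)) Filter.atTop
      (nhds (Complex.exp (-(∫ x, ‖p.2 x‖ ^ 2 ∂ρ : ℝ) / 4))) := by
    have hc : Continuous fun a : ℝ => Complex.exp (-(a : ℂ) / 4) := by fun_prop
    exact (hc.tendsto _).comp L2
  refine tendsto_nhds_unique L1 (L3.congr fun n => ?_)
  exact ((hS _ (hu n)).integral_exp).symm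

end Closure

/-! ### The derivative process -/

section Derivative

variable {Ω : Type*} [MeasurableSpace Ω] {P : Measure Ω} {f : ℝ → Ω → ℂ}

theorem norm_spectralExp_sub_le (s t l : ℝ) :
    ‖spectralExp t l - spectralExp s l‖ ≤ |t - s| * |l| := by
  have h : spectralExp t l - spectralExp s l =
      spectralExp s l * (Complex.exp (Complex.I * (-((t - s) * l) : ℝ)) - 1) := by
    have : Complex.exp (Complex.I * (-((t - s) * l) : ℝ)) = spectralExp (t - s) l := by
      rw [spectralExp]; congr 1; push_cast; ring
    rw [this, mul_sub, ← spectralExp_add]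
    simp
  rw [h, norm_mul, norm_spectralExp, one_mul, ← abs_mul]
  have := Real.norm_exp_I_mul_ofReal_sub_one_le (x := -((t - s) * l))
  simpa [Real.norm_eq_abs] using this

theorem hasDerivAt_spectralExp (t l : ℝ) :
    HasDerivAt (fun s => spectralExp s l) (-Complex.I * l * spectralExp t l) t := by
  have h1 : HasDerivAt (fun s : ℝ => -Complex.I * s * l) (-Complex.I * l) t := by
    have := ((Complex.ofRealCLM.hasDerivAt (x := t)).const_mul (-Complex.I)).mul_const (l : ℂ)
    simpa using this
  have := h1.cexp
  rw [mul_comm] at this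
  exact this

/-- Difference quotients converge along almost every path, and those of the exponentials are bounded
by `|l|`, which is in `L²(ρ)` by the second moment. -/
theorem deriv_mem_dominatedClosure {ρ : Measure ℝ} (hρ : MemLp (fun l : ℝ => l) 2 ρ)
    (hd : ∀ᵐ ω ∂P, ContDiff ℝ 1 (fun t => f t ω)) (t : ℝ) :
    ((fun ω => deriv (fun s => f s ω) t, fun l => -Complex.I * l * spectralExp t l) :
      (Ω → ℂ) × (ℝ → ℂ)) ∈ dominatedClosure P ρ (processSpan f) := by
  set h : ℕ → ℝ := fun n => 1 / ((n : ℝ) + 1) with hh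
  have hpos : ∀ n, 0 < h n := fun n => Nat.one_div_pos_of_nat
  have hlim : Filter.Tendsto (fun n => t + h n) Filter.atTop (nhdsWithin t {t}ᶜ) := by
    refine tendsto_nhdsWithin_iff.2 ⟨?_, Filter.Eventually.of_forall fun n => ?_⟩
    · have := (tendsto_const_nhds (x := t)).add (tendsto_one_div_add_atTop_nhds_zero_nat (𝕜 := ℝ))
      rwa [add_zero] at this
    · simpa using (hpos n).ne'
  refine ⟨fun n => ((h n : ℂ)⁻¹) • ((f (t + h n), spectralExp (t + h n)) - (f t, spectralExp t)),
    fun n => ?_, ?_, fun l => ?_, fun l => |l|, hρ.norm, fun n l => ?_⟩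
  · exact Submodule.smul_mem _ _ (Submodule.sub_mem _ (Submodule.subset_span ⟨_, rfl⟩)
      (Submodule.subset_span ⟨_, rfl⟩))
  · filter_upwards [hd] with ω hω
    have := (hω.differentiable one_ne_zero t).hasDerivAt.tendsto_slope.comp hlim
    refine this.congr fun n => ?_
    simp [slope_def_module]
  · have := (hasDerivAt_spectralExp t l).tendsto_slope.comp hlim
    refine this.congr fun n => ?_
    simp [slope_def_module]
  · have := norm_spectralExp_sub_le t (t + h n) l
    simp only [Prod.smul_snd, Prod.snd_sub, Pi.smul_apply, Pi.sub_apply, smul_eq_mul, norm_mul,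
      norm_inv, Complex.norm_real, Real.norm_eq_abs, abs_of_pos (hpos n)]
    rw [inv_mul_le_iff₀ (hpos n)]
    simpa [abs_of_pos (hpos n)] using this

end Derivative

/-! ### Passing to an everywhere smooth, measurable version -/

section Modification

variable {Ω : Type*} [MeasurableSpace Ω] {P : Measure Ω} {f : ℝ → Ω → ℂ}

/-- Joint measurability and Fubini require regularity for every `ω`. The process is set to zero on a
measurable null set outside which paths are smooth and agree with measurable versions at rational
times; continuity carries measurability to all times. -/
theorem exists_smooth_modification (hm : ∀ t, AEMeasurable (f t) P)
    (hd : ∀ᵐ ω ∂P, ContDiff ℝ 1 (fun t => f t ω)) :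
    ∃ g : ℝ → Ω → ℂ, (∀ t, Measurable (g t)) ∧ (∀ ω, ContDiff ℝ 1 (fun t => g t ω)) ∧
      ∀ᵐ ω ∂P, ∀ t, f t ω = g t ω := by
  have hq : ∀ᵐ ω ∂P, ∀ q : ℚ, f q ω = (hm q).mk _ ω :=
    ae_all_iff.2 fun q => (hm q).ae_eq_mk
  have hall := hd.and hq
  set N := toMeasurable P {ω | ¬ (ContDiff ℝ 1 (fun t => f t ω) ∧
    ∀ q : ℚ, f q ω = (hm q).mk _ ω)} with hN
  have hN0 : P N = 0 := by rw [hN, measure_toMeasurable]; exact hall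
  have hNm : MeasurableSet N := measurableSet_toMeasurable _ _
  have hgood : ∀ ω ∉ N, ContDiff ℝ 1 (fun t => f t ω) ∧ ∀ q : ℚ, f q ω = (hm q).mk _ ω := by
    intro ω hω
    by_contra h
    exact hω (subset_toMeasurable _ _ h)
  have hC : ∀ ω, ContDiff ℝ 1 (fun t => Nᶜ.indicator (f t) ω) := by
    intro ω
    by_cases h : ω ∈ N
    · simp [h, contDiff_const]
    · simpa [h] using (hgood ω h).1
  have hQ : ∀ q : ℚ, Measurable (Nᶜ.indicator (f q)) := by
    intro q
    have : Nᶜ.indicator (f q) = Nᶜ.indicator ((hm q).mk _) := by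
      ext ω
      by_cases h : ω ∈ N
      · simp [h]
      · simpa [h] using (hgood ω h).2 q
    rw [this]
    exact (hm q).measurable_mk.indicator hNm.compl
  refine ⟨fun t => Nᶜ.indicator (f t), fun t => ?_, hC, ?_⟩
  · obtain ⟨u, hu, hut⟩ := mem_closure_iff_seq_limit.1 (Rat.denseRange_cast (𝕜 := ℝ) t)
    refine measurable_of_tendsto_metrizable (f := fun n => Nᶜ.indicator (f (u n)))
      (fun n => ?_) (tendsto_pi_nhds.2 fun ω => ((hC ω).continuous.tendsto t).comp hut)
    obtain ⟨q, hq⟩ := hu n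
    rw [← hq]
    exact hQ q
  · have : ∀ᵐ ω ∂P, ω ∉ N := by rw [ae_iff]; simpa using hN0
    filter_upwards [this] with ω hω t
    simp [hω]

theorem measurable_uncurry_of_contDiff (hm : ∀ t, Measurable (f t))
    (hd : ∀ ω, ContDiff ℝ 1 (fun t => f t ω)) :
    Measurable (Function.uncurry f) :=
  measurable_uncurry_of_continuous_of_measurable (fun ω => (hd ω).continuous) hm

theorem measurable_uncurry_deriv_of_contDiff (hm : ∀ t, Measurable (f t))
    (hd : ∀ ω, ContDiff ℝ 1 (fun t => f t ω)) :
    Measurable (Function.uncurry fun t ω => deriv (fun s => f s ω) t) := by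
  refine measurable_uncurry_of_continuous_of_measurable
    (fun ω => (hd ω).continuous_deriv le_rfl) fun t => ?_
  have hlim : Filter.Tendsto (fun n : ℕ => t + 1 / ((n : ℝ) + 1)) Filter.atTop
      (nhdsWithin t {t}ᶜ) := by
    refine tendsto_nhdsWithin_iff.2 ⟨?_, Filter.Eventually.of_forall fun n => ?_⟩
    · have := (tendsto_const_nhds (x := t)).add (tendsto_one_div_add_atTop_nhds_zero_nat (𝕜 := ℝ))
      rwa [add_zero] at this
    · simpa using (Nat.one_div_pos_of_nat (α := ℝ) (n := n)).ne'
  refine measurable_of_tendsto_metrizable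
    (f := fun (n : ℕ) ω => slope (fun s => f s ω) t (t + 1 / ((n : ℝ) + 1))) (fun n => ?_)
    (tendsto_pi_nhds.2 fun ω =>
      ((hd ω).differentiable one_ne_zero t).hasDerivAt.tendsto_slope.comp hlim)
  simp only [slope_def_module]
  exact ((hm _).sub (hm _)).const_smul _

theorem IsGSP.congr {g : ℝ → Ω → ℂ} (hf : IsGSP f P) (h : ∀ᵐ ω ∂P, ∀ t, f t ω = g t ω) :
    IsGSP g P := by
  have e : ∀ (n : ℕ) (t : Fin n → ℝ),
      (fun ω i => f (t i) ω) =ᵐ[P] fun ω i => g (t i) ω := fun n t => by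
    filter_upwards [h] with ω hω
    ext i
    exact hω _
  refine ⟨fun n t => ?_, fun n t s => ?_⟩
  · obtain ⟨h1, m, A, hA⟩ := hf.gaussian n t
    exact ⟨h1.congr (e n t), m, A, by rw [← Measure.map_congr (e n t), hA]⟩
  · rw [← Measure.map_congr (e n t), ← Measure.map_congr (e n fun i => t i + s)]
    exact hf.stationary n t s

end Modification

/-! ### Second moment and nondegeneracy of the spectral measure -/

section SpectralMoments

variable {ρ : Measure ℝ}

theorem LogMomentCondition.memLp [IsFiniteMeasure ρ] (h : LogMomentCondition ρ) :
    MemLp (fun l : ℝ => l) 2 ρ := by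
  obtain ⟨α, hα, hi⟩ := h
  rw [memLp_two_iff_integrable_sq (by fun_prop)]
  refine ((integrable_const (4 : ℝ)).add hi).mono' (by fun_prop)
    (Filter.Eventually.of_forall fun l => ?_)
  rw [Real.norm_of_nonneg (sq_nonneg l), Pi.add_apply]
  have h0 : 0 ≤ Real.log (1 + |l|) := Real.log_nonneg (by linarith [abs_nonneg l])
  rcases le_total |l| 2 with h2 | h2
  · have : l ^ 2 ≤ 4 := by
      rw [← sq_abs]; nlinarith [abs_nonneg l]
    have := mul_nonneg (sq_nonneg l) (Real.rpow_nonneg h0 (1 + α))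
    linarith
  · have h1 : 1 ≤ Real.log (1 + |l|) := by
      rw [Real.le_log_iff_exp_le (by linarith)]
      linarith [Real.exp_one_lt_d9]
    have := Real.one_le_rpow h1 (by linarith : 0 ≤ 1 + α)
    nlinarith [sq_nonneg l]

theorem eq_dirac_of_compl_singleton [IsProbabilityMeasure ρ] {a : ℝ} (h : ρ {a}ᶜ = 0) :
    ρ = Measure.dirac a := by
  have : (fun x : ℝ => x) =ᵐ[ρ] fun _ => a := by
    filter_upwards [show ∀ᵐ x ∂ρ, x = a by rw [ae_iff]; exact h] with x hx using hx
  have hmap : ρ.map (fun x : ℝ => x) = ρ.map (fun _ => a) := Measure.map_congr this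
  rw [Measure.map_const, Measure.map_id'] at hmap
  simpa using hmap

theorem exists_pos_measure_annulus {E : Type*} [MeasurableSpace E]
    {μ : Measure E} {g : E → ℝ} (h : μ {x | g x ≠ 0} ≠ 0) :
    ∃ n : ℕ, 0 < n ∧ μ {x | (n : ℝ)⁻¹ ≤ |g x| ∧ |g x| ≤ n} ≠ 0 := by
  by_contra! hn
  refine h (measure_mono_null (fun x hx => ?_) (measure_iUnion_null fun n : ℕ =>
    hn (n + 1) n.succ_pos))
  have hx' : 0 < |g x| := abs_pos.2 hx
  obtain ⟨n, hn⟩ := exists_nat_ge (max |g x| |g x|⁻¹)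
  refine Set.mem_iUnion.2 ⟨n, ?_, ?_⟩
  · rw [inv_le_comm₀ (by positivity) hx']
    push_cast
    linarith [le_max_right |g x| |g x|⁻¹]
  · push_cast
    linarith [le_max_left |g x| |g x|⁻¹]

theorem measure_prod_offDiag_ne_zero [IsProbabilityMeasure ρ] (h : ¬ IsDegenerate ρ) :
    (ρ.prod ρ) {x : ℝ × ℝ | x.1 - x.2 ≠ 0} ≠ 0 := by
  intro h0
  have hm : MeasurableSet {x : ℝ × ℝ | x.1 - x.2 ≠ 0} :=
    (measurableSet_eq_fun (by fun_prop) (by fun_prop)).compl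
  rw [Measure.measure_prod_null hm] at h0
  obtain ⟨a, ha⟩ := h0.exists
  refine h ⟨a, eq_dirac_of_compl_singleton (measure_mono_null (fun b hb => ?_) ha)⟩
  simp only [Set.mem_preimage, Set.mem_ofPred_eq]
  rw [sub_ne_zero]
  exact fun hab => hb (by simp [hab])

theorem norm_integral_spectralExp_sq [IsProbabilityMeasure ρ] (t : ℝ) :
    ‖∫ l, spectralExp t l ∂ρ‖ ^ 2 = ∫ x, Real.cos ((x.1 - x.2) * t) ∂(ρ.prod ρ) := by
  have h : ((‖∫ l, spectralExp t l ∂ρ‖ ^ 2 : ℝ) : ℂ) =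
      ∫ x : ℝ × ℝ, spectralExp t x.1 * conj (spectralExp t x.2) ∂(ρ.prod ρ) := by
    push_cast
    rw [← Complex.mul_conj', ← integral_conj]
    exact (integral_prod_mul (fun l => spectralExp t l) (fun l => conj (spectralExp t l))).symm
  have hi : Integrable (fun x : ℝ × ℝ => spectralExp t x.1 * conj (spectralExp t x.2))
      (ρ.prod ρ) := by
    have hc := continuous_spectralExp t
    refine Integrable.of_bound (Continuous.aestronglyMeasurable (by fun_prop)) 1
      (Filter.Eventually.of_forall fun x => ?_)
    simp [norm_spectralExp]
  have h2 := congrArg Complex.re h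
  rw [Complex.ofReal_re] at h2
  rw [h2]
  refine (integral_re hi).symm.trans (integral_congr_ae (Filter.Eventually.of_forall fun x => ?_))
  simp only [conj_spectralExp]
  rw [spectralExp, spectralExp, ← Complex.exp_add]
  have : -Complex.I * t * x.1 + -Complex.I * ((-t : ℝ) : ℂ) * x.2 =
      ((-((x.1 - x.2) * t) : ℝ) : ℂ) * Complex.I := by push_cast; ring
  rw [this]
  simp only [RCLike.re_eq_complex_re]
  rw [Complex.exp_ofReal_mul_I_re, Real.cos_neg]

/-- The right-hand side is the mean of `1 - cos((x - y)t)` under `ρ ⊗ ρ`. A nondegenerate `ρ`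
charges some set `1/n ≤ |x - y| ≤ n`, where, for `|t| ≤ π/n`, the angle stays in `[-π, π]` and the
cosine has a quadratic upper bound. -/
theorem exists_one_sub_norm_sq_ge [IsProbabilityMeasure ρ] (h : ¬ IsDegenerate ρ) :
    ∃ κ > 0, ∃ τ > 0, ∀ t : ℝ, |t| ≤ τ →
      κ * t ^ 2 ≤ 1 - ‖∫ l, spectralExp t l ∂ρ‖ ^ 2 := by
  obtain ⟨n, hn, hB⟩ := exists_pos_measure_annulus (g := fun x : ℝ × ℝ => x.1 - x.2)
    (measure_prod_offDiag_ne_zero h)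
  set B := {x : ℝ × ℝ | (n : ℝ)⁻¹ ≤ |x.1 - x.2| ∧ |x.1 - x.2| ≤ n} with hBdef
  have hBm : MeasurableSet B :=
    ((measurable_fst.sub measurable_snd).abs (measurableSet_Icc (a := (n : ℝ)⁻¹) (b := n)))
  have hBpos : 0 < (ρ.prod ρ).real B :=
    ENNReal.toReal_pos hB (measure_ne_top _ _)
  have hn' : (0 : ℝ) < n := by exact_mod_cast hn
  refine ⟨2 / Real.pi ^ 2 * (n : ℝ)⁻¹ ^ 2 * (ρ.prod ρ).real B, by
    have := Real.pi_pos
    positivity, Real.pi / n, div_pos Real.pi_pos hn', fun t ht => ?_⟩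
  have hc : Integrable (fun x : ℝ × ℝ => Real.cos ((x.1 - x.2) * t)) (ρ.prod ρ) :=
    Integrable.of_bound (Continuous.aestronglyMeasurable (by fun_prop)) 1
      (Filter.Eventually.of_forall fun x => by simpa using Real.abs_cos_le_one _)
  have e : 1 - ‖∫ l, spectralExp t l ∂ρ‖ ^ 2 =
      ∫ x : ℝ × ℝ, (1 - Real.cos ((x.1 - x.2) * t)) ∂(ρ.prod ρ) := by
    rw [norm_integral_spectralExp_sq, integral_sub (integrable_const _) hc]
    simp
  rw [e]
  have e2 : 2 / Real.pi ^ 2 * (n : ℝ)⁻¹ ^ 2 * (ρ.prod ρ).real B * t ^ 2 =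
      ∫ _ in B, (2 / Real.pi ^ 2 * (n : ℝ)⁻¹ ^ 2 * t ^ 2) ∂(ρ.prod ρ) := by
    rw [setIntegral_const, smul_eq_mul]; ring
  rw [e2]
  refine le_trans (setIntegral_mono_on (integrable_const _).integrableOn
    ((integrable_const _).sub hc).integrableOn hBm fun x hx => ?_)
    (setIntegral_le_integral ((integrable_const _).sub hc)
      (Filter.Eventually.of_forall fun x => by
        simpa using Real.cos_le_one _))
  have hx1 : |(x.1 - x.2) * t| ≤ Real.pi := by
    rw [abs_mul]
    calc |x.1 - x.2| * |t| ≤ n * (Real.pi / n) :=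
          mul_le_mul hx.2 ht (abs_nonneg _) hn'.le
      _ = Real.pi := by field_simp
  simp only [Pi.sub_apply]
  have h3 := Real.cos_le_one_sub_mul_cos_sq hx1
  have h4 : (n : ℝ)⁻¹ ^ 2 ≤ (x.1 - x.2) ^ 2 := by
    rw [← sq_abs (x.1 - x.2)]
    exact pow_le_pow_left₀ (by positivity) hx.1 2
  have h5 : 2 / Real.pi ^ 2 * ((n : ℝ)⁻¹ ^ 2 * t ^ 2) ≤
      2 / Real.pi ^ 2 * ((x.1 - x.2) ^ 2 * t ^ 2) := by
    have := Real.pi_pos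
    gcongr
  have h6 : ((x.1 - x.2) * t) ^ 2 = (x.1 - x.2) ^ 2 * t ^ 2 := by ring
  rw [h6] at h3
  linarith

end SpectralMoments

/-! ### Two-point estimate for the logarithmic derivative -/

section TwoPoint

/-- A negative power of `x * y` is controlled by negative powers of `d`, `e` and of `x` or `y`
alone, if `d` and `e` are bounded by `x + y`. -/
theorem rpow_mul_le_of_le_add {x y d e : ℝ} (hx : 0 < x) (hy : 0 < y) (hd : 0 < d) (he : 0 < e)
    (hdxy : d ≤ x + y) (hexy : e ≤ x + y) : (x * y) ^ (-(6 / 5) : ℝ) ≤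
      2 * (d ^ (-(3 / 5) : ℝ) * x ^ (-(9 / 5) : ℝ)) +
        2 * (e ^ (-(3 / 5) : ℝ) * y ^ (-(9 / 5) : ℝ)) := by
  -- Half of the power of the larger variable `b` is traded for `a`, the other half for `e/2 ≤ b`.
  -- The exponent `-9/5` on `a` is still above `-2`, hence has finite Gaussian mean.
  have key : ∀ {a b e : ℝ}, 0 < a → 0 < b → 0 < e → e ≤ a + b → a ≤ b →
      (a * b) ^ (-(6 / 5) : ℝ) ≤ 2 * (e ^ (-(3 / 5) : ℝ) * a ^ (-(9 / 5) : ℝ)) := by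
    intro a b e ha hb he heab hab
    have h1 : b ^ (-(3 / 5) : ℝ) ≤ a ^ (-(3 / 5) : ℝ) :=
      Real.rpow_le_rpow_of_nonpos ha hab (by norm_num)
    have h2 : b ^ (-(3 / 5) : ℝ) ≤ (e / 2) ^ (-(3 / 5) : ℝ) :=
      Real.rpow_le_rpow_of_nonpos (by positivity) (by linarith) (by norm_num)
    have h3 : (e / 2) ^ (-(3 / 5) : ℝ) ≤ 2 * e ^ (-(3 / 5) : ℝ) := by
      rw [div_eq_mul_inv, Real.mul_rpow he.le (by norm_num), mul_comm]
      refine mul_le_mul_of_nonneg_right ?_ (by positivity)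
      rw [Real.inv_rpow (by norm_num), ← Real.rpow_neg (by norm_num), neg_neg]
      calc (2 : ℝ) ^ (3 / 5 : ℝ) ≤ 2 ^ (1 : ℝ) :=
            Real.rpow_le_rpow_of_exponent_le (by norm_num) (by norm_num)
        _ = 2 := by norm_num
    have e1 : (a * b) ^ (-(6 / 5) : ℝ) =
        a ^ (-(6 / 5) : ℝ) * (b ^ (-(3 / 5) : ℝ) * b ^ (-(3 / 5) : ℝ)) := by
      rw [Real.mul_rpow ha.le hb.le, ← Real.rpow_add hb]; norm_num
    have e2 : a ^ (-(9 / 5) : ℝ) = a ^ (-(6 / 5) : ℝ) * a ^ (-(3 / 5) : ℝ) := by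
      rw [← Real.rpow_add ha]; norm_num
    rw [e1, e2]
    calc a ^ (-(6 / 5) : ℝ) * (b ^ (-(3 / 5) : ℝ) * b ^ (-(3 / 5) : ℝ))
        ≤ a ^ (-(6 / 5) : ℝ) * (a ^ (-(3 / 5) : ℝ) * (2 * e ^ (-(3 / 5) : ℝ))) := by
          have := h2.trans h3
          gcongr
      _ = _ := by ring
  have p1 : 0 ≤ d ^ (-(3 / 5) : ℝ) * x ^ (-(9 / 5) : ℝ) := by positivity
  have p2 : 0 ≤ e ^ (-(3 / 5) : ℝ) * y ^ (-(9 / 5) : ℝ) := by positivity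
  rcases le_total x y with hxy | hxy
  · have := key hx hy hd hdxy hxy
    linarith
  · have := key hy hx he (by linarith) hxy
    rw [mul_comm] at this
    linarith

/-- Young's inequality with exponents `6` and `6/5` separates numerators, which have all moments,
from denominators, which tolerate powers only slightly above one. -/
theorem div_mul_div_le {a b x y : ℝ} (ha : 0 ≤ a) (hb : 0 ≤ b) (hx : 0 < x) (hy : 0 < y) :
    a / x * (b / y) ≤ a ^ 12 + b ^ 12 + (x * y) ^ (-(6 / 5) : ℝ) := by
  have h := Real.young_inequality_of_nonneg (a := a * b) (b := (x * y)⁻¹) (p := 6) (q := 6 / 5)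
    (by positivity) (by positivity) (by rw [Real.holderConjugate_iff]; norm_num)
  have e1 : a / x * (b / y) = a * b * (x * y)⁻¹ := by
    rw [div_mul_div_comm, div_eq_mul_inv]
  have e2 : ((x * y)⁻¹) ^ (6 / 5 : ℝ) = (x * y) ^ (-(6 / 5) : ℝ) := by
    rw [Real.inv_rpow (by positivity), ← Real.rpow_neg (by positivity)]
  have e3 : (a * b) ^ (6 : ℝ) = a ^ 6 * b ^ 6 := by
    rw [show (6 : ℝ) = ((6 : ℕ) : ℝ) by norm_num, Real.rpow_natCast, mul_pow]
  rw [e2, e3] at h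
  rw [e1]
  have h1 : 0 ≤ (x * y) ^ (-(6 / 5) : ℝ) := by positivity
  have h2 : a ^ 6 * b ^ 6 ≤ a ^ 12 + b ^ 12 := by
    nlinarith [sq_nonneg (a ^ 6 - b ^ 6), pow_nonneg ha 12, pow_nonneg hb 12]
  have h3 : 0 ≤ a ^ 6 * b ^ 6 := by positivity
  have h4 : (x * y) ^ (-(6 / 5) : ℝ) / (6 / 5) ≤ (x * y) ^ (-(6 / 5) : ℝ) := by
    rw [div_le_iff₀ (by norm_num)]; linarith
  linarith

variable {Ω E : Type*} [MeasurableSpace Ω] [MeasurableSpace E]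
  {P : Measure Ω} {ρ : Measure E} {S : Submodule ℂ ((Ω → ℂ) × (E → ℂ))}

theorem IsIsonormal.ae_ne_zero [IsProbabilityMeasure P] (hS : IsIsonormal P ρ S)
    {p : (Ω → ℂ) × (E → ℂ)} (hp : p ∈ S) (h : 0 < ∫ x, ‖p.2 x‖ ^ 2 ∂ρ) :
    ∀ᵐ ω ∂P, p.1 ω ≠ 0 := by
  have hσ := Real.sqrt_pos.2 h
  have : ∀ᵐ z ∂(P.map p.1), z ≠ 0 := by
    have hm0 : MeasurableSet {z : ℂ | z ≠ 0} := (measurableSet_singleton (0 : ℂ)).compl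
    rw [hS.map_eq hp, ae_map_iff (by fun_prop) hm0]
    have : ∀ᵐ z ∂stdComplexGaussian, z ≠ 0 := by
      rw [ae_iff]; simpa using stdComplexGaussian_singleton 0
    filter_upwards [this] with z hz
    exact smul_ne_zero hσ.ne' hz
  exact ae_of_ae_map (hS _ hp).aemeasurable this

theorem IsIsonormal.integrable_norm_rpow [IsProbabilityMeasure P] (hS : IsIsonormal P ρ S)
    {p : (Ω → ℂ) × (E → ℂ)} (hp : p ∈ S) {q : ℝ} (hq : -2 < q) :
    Integrable (fun ω => ‖p.1 ω‖ ^ q) P ∧ ∫ ω, ‖p.1 ω‖ ^ q ∂P =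
      Real.sqrt (∫ x, ‖p.2 x‖ ^ 2 ∂ρ) ^ q * ∫ z : ℂ, ‖z‖ ^ q ∂stdComplexGaussian := by
  have hm : Measurable fun z : ℂ => ‖z‖ ^ q := by fun_prop
  have e : (fun z : ℂ => ‖Real.sqrt (∫ x, ‖p.2 x‖ ^ 2 ∂ρ) • z‖ ^ q) =
      fun z : ℂ => Real.sqrt (∫ x, ‖p.2 x‖ ^ 2 ∂ρ) ^ q * ‖z‖ ^ q := by
    ext z
    rw [norm_smul, Real.norm_of_nonneg (Real.sqrt_nonneg _),
      Real.mul_rpow (Real.sqrt_nonneg _) (norm_nonneg _)]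
  constructor
  · have h : Integrable (fun z : ℂ => ‖z‖ ^ q) (P.map p.1) := by
      rw [hS.map_eq hp, integrable_map_measure hm.aestronglyMeasurable (by fun_prop)]
      simp only [Function.comp_def]
      rw [e]
      exact (integrable_norm_rpow_stdComplexGaussian hq).const_mul _
    exact h.comp_aemeasurable (hS _ hp).aemeasurable
  · rw [← integral_map (f := fun z : ℂ => ‖z‖ ^ q) (hS p hp).aemeasurable
      hm.aestronglyMeasurable, hS.map_eq hp, integral_map (by fun_prop) hm.aestronglyMeasurable, e, integral_const_mul]

/-- The constant of the negative moment estimate. -/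
noncomputable def negMomentConst : ℝ :=
  (∫ z : ℂ, ‖z‖ ^ (-(3 / 5) : ℝ) ∂stdComplexGaussian) *
    ∫ z : ℂ, ‖z‖ ^ (-(9 / 5) : ℝ) ∂stdComplexGaussian

theorem negMomentConst_nonneg : 0 ≤ negMomentConst :=
  mul_nonneg (integral_nonneg fun z => by positivity) (integral_nonneg fun z => by positivity)

/-- Orthogonality makes `q` independent of `p`, so the mean factors. The standard deviation of `q`
appears only to the power `-3/5`, which becomes the singularity in time. -/
theorem IsIsonormal.integral_neg_moments [IsProbabilityMeasure P] (hS : IsIsonormal P ρ S)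
    {p q : (Ω → ℂ) × (E → ℂ)} (hp : p ∈ S) (hq : q ∈ S) (hp1 : ∫ x, ‖p.2 x‖ ^ 2 ∂ρ = 1)
    (hpq : ∫ x, q.2 x * conj (p.2 x) ∂ρ = 0) :
    Integrable (fun ω => ‖q.1 ω‖ ^ (-(3 / 5) : ℝ) * ‖p.1 ω‖ ^ (-(9 / 5) : ℝ)) P ∧
      ∫ ω, ‖q.1 ω‖ ^ (-(3 / 5) : ℝ) * ‖p.1 ω‖ ^ (-(9 / 5) : ℝ) ∂P =
        Real.sqrt (∫ x, ‖q.2 x‖ ^ 2 ∂ρ) ^ (-(3 / 5) : ℝ) * negMomentConst := by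
  have h1 := hS.integrable_norm_rpow hq (q := -(3 / 5)) (by norm_num)
  have h2 := hS.integrable_norm_rpow hp (q := -(9 / 5)) (by norm_num)
  have hind : IndepFun (fun ω => ‖q.1 ω‖ ^ (-(3 / 5) : ℝ)) (fun ω => ‖p.1 ω‖ ^ (-(9 / 5) : ℝ)) P :=
    (hS.indepFun hp hq hq hq hpq hpq hpq).symm.comp
      (φ := fun y : ℂ × ℂ × ℂ => ‖y.1‖ ^ (-(3 / 5) : ℝ))
      (ψ := fun z : ℂ => ‖z‖ ^ (-(9 / 5) : ℝ)) (by fun_prop) (by fun_prop)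
  refine ⟨hind.integrable_mul h1.1 h2.1, ?_⟩
  rw [hind.integral_fun_mul_eq_mul_integral h1.1.aestronglyMeasurable h2.1.aestronglyMeasurable,
    h1.2, h2.2, hp1, Real.sqrt_one, Real.one_rpow, one_mul, negMomentConst]
  ring

/-- The constant of the two-point estimate, for derivatives of variance `v`. -/
noncomputable def twoPointConst (v : ℝ) : ℝ :=
  2 * (Real.sqrt v ^ (12 : ℝ) * ∫ z : ℂ, ‖z‖ ^ (12 : ℝ) ∂stdComplexGaussian)

/-- The two denominators are nearly dependent at close times, so each is compared with the residual
of the other after projection. The residual has variance `1 - ‖c‖² ≥ β²` and is independent of the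
variable projected on; since `‖c‖ ≤ 1`, it is bounded by the sum of the two moduli, as
`rpow_mul_le_of_le_add` requires. -/
theorem IsIsonormal.lintegral_two_point_le [IsProbabilityMeasure P] (hS : IsIsonormal P ρ S)
    {z z' w w' : (Ω → ℂ) × (E → ℂ)} (hz : z ∈ S) (hz' : z' ∈ S) (hw : w ∈ S) (hw' : w' ∈ S)
    (hz1 : ∫ x, ‖z.2 x‖ ^ 2 ∂ρ = 1) (hz1' : ∫ x, ‖z'.2 x‖ ^ 2 ∂ρ = 1) {v : ℝ}
    (hv : ∫ x, ‖w.2 x‖ ^ 2 ∂ρ = v) (hv' : ∫ x, ‖w'.2 x‖ ^ 2 ∂ρ = v)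
    {β : ℝ} (hβ : 0 < β) (hβc : β ^ 2 ≤ 1 - ‖∫ x, z'.2 x * conj (z.2 x) ∂ρ‖ ^ 2) :
    ∫⁻ ω, ‖w.1 ω / z.1 ω‖ₑ * ‖w'.1 ω / z'.1 ω‖ₑ ∂P ≤
      ENNReal.ofReal (twoPointConst v + 4 * negMomentConst * β ^ (-(3 / 5) : ℝ)) := by
  set c := ∫ x, z'.2 x * conj (z.2 x) ∂ρ with hc
  have hcc : ∫ x, z.2 x * conj (z'.2 x) ∂ρ = conj c := by
    rw [hc, ← integral_conj]
    exact integral_congr_ae (Filter.Eventually.of_forall fun x => by simp [mul_comm])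
  have hc1 : ‖c‖ ≤ 1 := by
    have : ‖c‖ ^ 2 ≤ 1 := by nlinarith
    exact (sq_le_one_iff₀ (norm_nonneg _)).1 this
  have aux : ∀ {p q : (Ω → ℂ) × (E → ℂ)} (d : ℂ), p ∈ S → q ∈ S →
      ∫ x, ‖p.2 x‖ ^ 2 ∂ρ = 1 → ∫ x, ‖q.2 x‖ ^ 2 ∂ρ = 1 →
      ∫ x, q.2 x * conj (p.2 x) ∂ρ = d → ‖d‖ = ‖c‖ →
      (∀ᵐ ω ∂P, q.1 ω + (-d) * p.1 ω ≠ 0) ∧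
      Integrable (fun ω => ‖q.1 ω + (-d) * p.1 ω‖ ^ (-(3 / 5) : ℝ) *
        ‖p.1 ω‖ ^ (-(9 / 5) : ℝ)) P ∧
      ∫ ω, ‖q.1 ω + (-d) * p.1 ω‖ ^ (-(3 / 5) : ℝ) * ‖p.1 ω‖ ^ (-(9 / 5) : ℝ) ∂P ≤
        β ^ (-(3 / 5) : ℝ) * negMomentConst := by
    intro p q d hp hq hp1 hq1 hd hdc
    have hmem : q + (-d) • p ∈ S := S.add_mem hq (S.smul_mem _ hp)
    have hpp : ∫ x, p.2 x * conj (p.2 x) ∂ρ = 1 := by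
      simp only [Complex.mul_conj']
      exact_mod_cast congrArg (fun t : ℝ => (t : ℂ)) hp1
    have horth : ∫ x, (q + (-d) • p).2 x * conj (p.2 x) ∂ρ = 0 := by
      have i1 := memLp_two_mul_conj (hS _ hq).memLp (hS _ hp).memLp
      have i2 := memLp_two_mul_conj (hS _ hp).memLp (hS _ hp).memLp
      simp only [Prod.snd_add, Prod.smul_snd, Pi.add_apply, Pi.smul_apply, smul_eq_mul, add_mul,
        mul_assoc]
      rw [integral_add i1 (i2.const_mul _), integral_const_mul, hpp, hd]
      ring
    have hnorm : ∫ x, ‖(q + (-d) • p).2 x‖ ^ 2 ∂ρ = 1 - ‖c‖ ^ 2 := by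
      have := integral_norm_add_smul_sq (hS _ hq).memLp (hS _ hp).memLp (-d)
      simp only [Prod.snd_add, Prod.smul_snd, Pi.add_apply, Pi.smul_apply, smul_eq_mul]
      rw [this, hp1, hq1, hd, ← hdc, map_neg, neg_mul, Complex.conj_mul', norm_neg]
      have : (-(‖d‖ : ℂ) ^ 2).re = -‖d‖ ^ 2 := by
        rw [Complex.neg_re, ← Complex.ofReal_pow, Complex.ofReal_re]
      rw [this]
      ring
    have hpos : 0 < ∫ x, ‖(q + (-d) • p).2 x‖ ^ 2 ∂ρ := by
      rw [hnorm]; exact lt_of_lt_of_le (by positivity) hβc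
    have hm := hS.integral_neg_moments hp hmem hp1 horth
    refine ⟨hS.ae_ne_zero hmem hpos, hm.1, hm.2.le.trans ?_⟩
    refine mul_le_mul_of_nonneg_right ?_ negMomentConst_nonneg
    refine Real.rpow_le_rpow_of_nonpos hβ ?_ (by norm_num)
    rw [hnorm]
    exact Real.le_sqrt_of_sq_le hβc
  obtain ⟨A1, A2, A3⟩ := aux c hz hz' hz1 hz1' hc.symm rfl
  obtain ⟨B1, B2, B3⟩ := aux (conj c) hz' hz hz1' hz1 hcc (RCLike.norm_conj _)
  have W := hS.integrable_norm_rpow hw (q := 12) (by norm_num)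
  have W' := hS.integrable_norm_rpow hw' (q := 12) (by norm_num)
  rw [hv] at W
  rw [hv'] at W'
  have Z := hS.ae_ne_zero hz (by rw [hz1]; norm_num)
  have Z' := hS.ae_ne_zero hz' (by rw [hz1']; norm_num)
  set t₁ : Ω → ℝ := fun ω =>
    ‖z'.1 ω + (-c) * z.1 ω‖ ^ (-(3 / 5) : ℝ) * ‖z.1 ω‖ ^ (-(9 / 5) : ℝ)
  set t₂ : Ω → ℝ := fun ω =>
    ‖z.1 ω + (-conj c) * z'.1 ω‖ ^ (-(3 / 5) : ℝ) * ‖z'.1 ω‖ ^ (-(9 / 5) : ℝ)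
  have Iw : Integrable (fun ω => ‖w.1 ω‖ ^ (12 : ℝ) + ‖w'.1 ω‖ ^ (12 : ℝ)) P := W.1.add W'.1
  have It : Integrable (fun ω => 2 * t₁ ω + 2 * t₂ ω) P := (A2.const_mul 2).add (B2.const_mul 2)
  have hle : ∀ᵐ ω ∂P, ‖w.1 ω / z.1 ω‖ₑ * ‖w'.1 ω / z'.1 ω‖ₑ ≤
      ENNReal.ofReal (‖w.1 ω‖ ^ (12 : ℝ) + ‖w'.1 ω‖ ^ (12 : ℝ) + (2 * t₁ ω + 2 * t₂ ω)) := by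
    filter_upwards [A1, B1, Z, Z'] with ω a1 b1 hzω hzω'
    have pz := norm_pos_iff.2 hzω
    have pz' := norm_pos_iff.2 hzω'
    rw [← enorm_mul, ← ofReal_norm, norm_mul, norm_div, norm_div]
    refine ENNReal.ofReal_le_ofReal ?_
    refine (div_mul_div_le (norm_nonneg _) (norm_nonneg _) pz pz').trans ?_
    rw [show (12 : ℝ) = ((12 : ℕ) : ℝ) by norm_num, Real.rpow_natCast, Real.rpow_natCast]
    refine add_le_add le_rfl ?_
    have tri : ∀ {x y d : ℂ}, ‖d‖ ≤ 1 → ‖y + (-d) * x‖ ≤ ‖x‖ + ‖y‖ := by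
      intro x y d hd
      refine (norm_add_le _ _).trans ?_
      rw [norm_mul, norm_neg]
      nlinarith [norm_nonneg x]
    refine rpow_mul_le_of_le_add pz pz' (norm_pos_iff.2 a1) (norm_pos_iff.2 b1) (tri hc1) ?_
    rw [add_comm ‖z.1 ω‖]
    exact tri (by rwa [RCLike.norm_conj])
  refine (lintegral_mono_ae hle).trans ?_
  have IF : Integrable (fun ω => ‖w.1 ω‖ ^ (12 : ℝ) + ‖w'.1 ω‖ ^ (12 : ℝ) +
      (2 * t₁ ω + 2 * t₂ ω)) P := Iw.add It
  rw [← ofReal_integral_eq_lintegral_ofReal IF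
    (Filter.Eventually.of_forall fun ω => by positivity)]
  refine ENNReal.ofReal_le_ofReal ?_
  rw [integral_add Iw It, integral_add W.1 W'.1,
    integral_add (A2.const_mul 2) (B2.const_mul 2), integral_const_mul, integral_const_mul, W.2,
    W'.2, twoPointConst]
  linarith

end TwoPoint

/-! ### Square-integrability and Fubini for time integrals -/

section TimeIntegrals

variable {Ω : Type*} [MeasurableSpace Ω] {P : Measure Ω}

theorem integrableOn_abs_rpow {τ : ℝ} (hτ : 0 < τ) {q : ℝ} (hq : -1 < q) :
    IntegrableOn (fun u : ℝ => |u| ^ q) (Set.Icc (-τ) τ) := by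
  have h1 : IntervalIntegrable (fun u : ℝ => |u| ^ q) volume 0 τ := by
    refine (intervalIntegral.intervalIntegrable_rpow' hq).congr ?_
    intro u hu
    rw [Set.uIoc_of_le hτ.le] at hu
    simp only [abs_of_pos hu.1]
  have h2 : IntervalIntegrable (fun u : ℝ => |u| ^ q) volume (-τ) 0 := by
    have := (IntervalIntegrable.iff_comp_neg).1 h1
    simpa using this.symm
  have h3 := h2.trans h1
  rwa [intervalIntegrable_iff_integrableOn_Icc_of_le (by linarith)] at h3

/-- The square is a double time integral; after Tonelli the bound depends only on `s - t`, and `|u|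
^ q` is integrable near zero for `q > -1`. The diagonal, where the bound is not assumed, is null. -/
theorem lintegral_sq_Ioc_lt_top_of_le [SFinite P] {X : ℝ → Ω → ℝ}
    (hX : Measurable (Function.uncurry X)) {τ A B q : ℝ} (hτ : 0 < τ) (hq : -1 < q)
    (hK : ∀ s t : ℝ, s ≠ t → |s - t| ≤ τ →
      ∫⁻ ω, ‖X s ω‖ₑ * ‖X t ω‖ₑ ∂P ≤ ENNReal.ofReal (A + B * |s - t| ^ q))
    {a b : ℝ} (hab : b - a ≤ τ) :
    ∫⁻ ω, (∫⁻ s in Set.Ioc a b, ‖X s ω‖ₑ) ^ 2 ∂P < ⊤ := by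
  have hXω : ∀ ω, Measurable fun s => ‖X s ω‖ₑ := fun ω =>
    (hX.comp (measurable_id.prodMk measurable_const)).enorm
  have e1 : ∀ ω, (∫⁻ s in Set.Ioc a b, ‖X s ω‖ₑ) ^ 2 =
      ∫⁻ s in Set.Ioc a b, ∫⁻ t in Set.Ioc a b, ‖X s ω‖ₑ * ‖X t ω‖ₑ := by
    intro ω
    rw [sq, lintegral_lintegral_mul (hXω ω).aemeasurable (hXω ω).aemeasurable]
  have m3 : Measurable fun x : (Ω × ℝ) × ℝ => ‖X x.1.2 x.1.1‖ₑ * ‖X x.2 x.1.1‖ₑ := by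
    have h1 : Measurable fun x : (Ω × ℝ) × ℝ => X x.1.2 x.1.1 :=
      hX.comp ((measurable_snd.comp measurable_fst).prodMk (measurable_fst.comp measurable_fst))
    have h2 : Measurable fun x : (Ω × ℝ) × ℝ => X x.2 x.1.1 :=
      hX.comp (measurable_snd.prodMk (measurable_fst.comp measurable_fst))
    exact h1.enorm.mul h2.enorm
  have m2 : Measurable fun x : Ω × ℝ =>
      ∫⁻ t in Set.Ioc a b, ‖X x.2 x.1‖ₑ * ‖X t x.1‖ₑ := m3.lintegral_prod_right'
  simp only [e1]
  rw [lintegral_lintegral_swap m2.aemeasurable]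
  have e2 : ∀ s, ∫⁻ ω, (∫⁻ t in Set.Ioc a b, ‖X s ω‖ₑ * ‖X t ω‖ₑ) ∂P =
      ∫⁻ t in Set.Ioc a b, ∫⁻ ω, ‖X s ω‖ₑ * ‖X t ω‖ₑ ∂P := by
    intro s
    refine lintegral_lintegral_swap (Measurable.aemeasurable ?_)
    have h1 : Measurable fun x : Ω × ℝ => X s x.1 :=
      hX.comp (measurable_const.prodMk measurable_fst)
    have h2 : Measurable fun x : Ω × ℝ => X x.2 x.1 := hX.comp measurable_swap
    exact h1.enorm.mul h2.enorm
  simp only [e2]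
  set G : ℝ → ENNReal := fun u => ENNReal.ofReal (A + B * |u| ^ q) with hG
  set K := ∫⁻ u in Set.Icc (-τ) τ, G u with hKdef
  have hKfin : K < ⊤ := by
    have : IntegrableOn (fun u : ℝ => A + B * |u| ^ q) (Set.Icc (-τ) τ) :=
      (integrableOn_const (by simp)).add ((integrableOn_abs_rpow hτ hq).const_mul B)
    exact this.lintegral_lt_top
  have hin : ∀ s ∈ Set.Ioc a b, ∫⁻ t in Set.Ioc a b, ∫⁻ ω, ‖X s ω‖ₑ * ‖X t ω‖ₑ ∂P ≤ K := by
    intro s hs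
    have hne : ∀ᵐ t ∂(volume.restrict (Set.Ioc a b)), s ≠ t := by
      refine ae_restrict_of_ae ?_
      rw [ae_iff]
      simp
    calc ∫⁻ t in Set.Ioc a b, ∫⁻ ω, ‖X s ω‖ₑ * ‖X t ω‖ₑ ∂P
        ≤ ∫⁻ t in Set.Ioc a b, (Set.Icc (-τ) τ).indicator G (s - t) := by
          refine lintegral_mono_ae ?_
          filter_upwards [hne, ae_restrict_mem measurableSet_Ioc] with t hst ht
          have habs : |s - t| ≤ τ := by
            rw [abs_le]; constructor <;> linarith [hs.1, hs.2, ht.1, ht.2]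
          have hmem : s - t ∈ Set.Icc (-τ) τ := abs_le.1 habs
          rw [Set.indicator_of_mem hmem]
          exact hK s t hst habs
      _ ≤ ∫⁻ t, (Set.Icc (-τ) τ).indicator G (s - t) := setLIntegral_le_lintegral _ _
      _ = ∫⁻ u, (Set.Icc (-τ) τ).indicator G u :=
          lintegral_sub_left_eq_self ((Set.Icc (-τ) τ).indicator G) s
      _ = K := lintegral_indicator measurableSet_Icc _
  calc ∫⁻ s in Set.Ioc a b, ∫⁻ t in Set.Ioc a b, ∫⁻ ω, ‖X s ω‖ₑ * ‖X t ω‖ₑ ∂P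
      ≤ ∫⁻ _ in Set.Ioc a b, K := setLIntegral_mono' measurableSet_Ioc hin
    _ < ⊤ := by
      rw [setLIntegral_const]
      exact ENNReal.mul_lt_top hKfin (by simp)

theorem add_sq_le_four_mul (x y : ENNReal) : (x + y) ^ 2 ≤ 4 * (x ^ 2 + y ^ 2) := by
  have h : ∀ {a b : ENNReal}, a ≤ b → (a + b) ^ 2 ≤ 4 * (a ^ 2 + b ^ 2) := by
    intro a b hab
    calc (a + b) ^ 2 ≤ (b + b) ^ 2 := by gcongr
      _ = 4 * b ^ 2 := by ring
      _ ≤ 4 * (a ^ 2 + b ^ 2) := by gcongr; exact le_add_self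
  rcases le_total x y with hxy | hxy
  · exact h hxy
  · rw [add_comm x, add_comm (x ^ 2)]; exact h hxy

theorem measurable_lintegral_enorm {X : ℝ → Ω → ℝ} (hX : Measurable (Function.uncurry X))
    (I : Set ℝ) : Measurable fun ω => ∫⁻ s in I, ‖X s ω‖ₑ := by
  have : Measurable fun x : Ω × ℝ => ‖X x.2 x.1‖ₑ := (hX.comp measurable_swap).enorm
  exact this.lintegral_prod_right'

/-- The hypothesis is local, so `[0,T]` is covered by intervals of length `τ`, added one at a time.
-/
theorem lintegral_sq_Ioc_lt_top [SFinite P] {X : ℝ → Ω → ℝ}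
    (hX : Measurable (Function.uncurry X)) {τ A B q : ℝ} (hτ : 0 < τ) (hq : -1 < q)
    (hK : ∀ s t : ℝ, s ≠ t → |s - t| ≤ τ →
      ∫⁻ ω, ‖X s ω‖ₑ * ‖X t ω‖ₑ ∂P ≤ ENNReal.ofReal (A + B * |s - t| ^ q)) (T : ℝ) :
    ∫⁻ ω, (∫⁻ s in Set.Ioc 0 T, ‖X s ω‖ₑ) ^ 2 ∂P < ⊤ := by
  have hn : ∀ n : ℕ, ∫⁻ ω, (∫⁻ s in Set.Ioc 0 (n * τ), ‖X s ω‖ₑ) ^ 2 ∂P < ⊤ := by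
    intro n
    induction n with
    | zero => simp
    | succ n ih =>
      have h2 := lintegral_sq_Ioc_lt_top_of_le hX hτ hq hK (a := n * τ) (b := (n + 1 : ℕ) * τ)
        (by push_cast; linarith)
      have hm : Measurable fun ω => (∫⁻ s in Set.Ioc 0 (n * τ), ‖X s ω‖ₑ) ^ 2 :=
        (measurable_lintegral_enorm hX _).pow_const 2
      have h3 : ∫⁻ ω, 4 * ((∫⁻ s in Set.Ioc 0 (n * τ), ‖X s ω‖ₑ) ^ 2 +
          (∫⁻ s in Set.Ioc (n * τ) ((n + 1 : ℕ) * τ), ‖X s ω‖ₑ) ^ 2) ∂P < ⊤ := by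
        rw [lintegral_const_mul' _ _ (by simp), lintegral_add_left hm]
        exact ENNReal.mul_lt_top (by simp) (ENNReal.add_lt_top.2 ⟨ih, h2⟩)
      refine lt_of_le_of_lt (lintegral_mono fun ω => ?_) h3
      refine le_trans ?_ (add_sq_le_four_mul _ _)
      have hsub : Set.Ioc 0 ((n + 1 : ℕ) * τ) ⊆
          Set.Ioc 0 (n * τ) ∪ Set.Ioc (n * τ) ((n + 1 : ℕ) * τ) := by
        intro x hx
        rcases le_or_gt x (n * τ) with hxn | hxn
        · exact Or.inl ⟨hx.1, hxn⟩
        · exact Or.inr ⟨hxn, hx.2⟩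
      gcongr
      exact (lintegral_mono_set hsub).trans (lintegral_union_le _ _ _)
  obtain ⟨n, hnT⟩ := exists_nat_ge (T / τ)
  refine lt_of_le_of_lt (lintegral_mono fun ω => ?_) (hn n)
  have : T ≤ n * τ := (div_le_iff₀ hτ).1 hnT
  gcongr

theorem memLp_two_integral {X : ℝ → Ω → ℝ} (hX : Measurable (Function.uncurry X)) {I : Set ℝ}
    (h : ∫⁻ ω, (∫⁻ s in I, ‖X s ω‖ₑ) ^ 2 ∂P < ⊤) :
    MemLp (fun ω => ∫ s in I, X s ω) 2 P := by
  have hm : StronglyMeasurable fun x : Ω × ℝ => X x.2 x.1 :=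
    (hX.comp measurable_swap).stronglyMeasurable
  refine ⟨hm.integral_prod_right'.aestronglyMeasurable, ?_⟩
  rw [eLpNorm_lt_top_iff_lintegral_rpow_enorm_lt_top (by simp) (by simp)]
  refine lt_of_le_of_lt (lintegral_mono fun ω => ?_) h
  simp only [ENNReal.toReal_ofNat, ENNReal.rpow_ofNat]
  gcongr
  exact enorm_integral_le_lintegral_enorm _

theorem integral_mul_time_integrals [SFinite P] {X Y : ℝ → Ω → ℝ}
    (hX : Measurable (Function.uncurry X)) (hY : Measurable (Function.uncurry Y)) {I : Set ℝ}
    (h : ∫⁻ ω, (∫⁻ s in I, ‖X s ω‖ₑ) ^ 2 ∂P < ⊤)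
    (h' : ∫⁻ ω, (∫⁻ s in I, ‖Y s ω‖ₑ) ^ 2 ∂P < ⊤) :
    ∫ ω, (∫ s in I, X s ω) * (∫ s in I, Y s ω) ∂P =
      ∫ x, (∫ ω, X x.1 ω * Y x.2 ω ∂P) ∂((volume.restrict I).prod (volume.restrict I)) := by
  have e : ∀ ω, (∫ s in I, X s ω) * (∫ s in I, Y s ω) =
      ∫ x, X x.1 ω * Y x.2 ω ∂((volume.restrict I).prod (volume.restrict I)) := fun ω =>
    (integral_prod_mul (fun s => X s ω) (fun s => Y s ω)).symm
  simp only [e]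
  have h1 : Measurable fun x : Ω × (ℝ × ℝ) => X x.2.1 x.1 :=
    hX.comp ((measurable_fst.comp measurable_snd).prodMk measurable_fst)
  have h2 : Measurable fun x : Ω × (ℝ × ℝ) => Y x.2.2 x.1 :=
    hY.comp ((measurable_snd.comp measurable_snd).prodMk measurable_fst)
  refine integral_integral_swap ⟨(h1.mul h2).aestronglyMeasurable, ?_⟩
  have h3 : Measurable fun x : Ω × (ℝ × ℝ) => ‖X x.2.1 x.1 * Y x.2.2 x.1‖ₑ := (h1.mul h2).enorm
  refine hasFiniteIntegral_iff_enorm.2 (lt_of_eq_of_lt (lintegral_prod _ h3.aemeasurable) ?_)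
  have h4 : ∫⁻ ω, ((∫⁻ s in I, ‖X s ω‖ₑ) ^ 2 + (∫⁻ s in I, ‖Y s ω‖ₑ) ^ 2) ∂P < ⊤ := by
    rw [lintegral_add_left ((measurable_lintegral_enorm hX _).pow_const 2)]
    exact ENNReal.add_lt_top.2 ⟨h, h'⟩
  refine lt_of_le_of_lt (lintegral_mono fun ω => ?_) h4
  have hXω : Measurable fun s => ‖X s ω‖ₑ :=
    (hX.comp (measurable_id.prodMk measurable_const)).enorm
  have hYω : Measurable fun s => ‖Y s ω‖ₑ :=
    (hY.comp (measurable_id.prodMk measurable_const)).enorm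
  simp only [Function.uncurry_apply_pair, enorm_mul]
  rw [lintegral_prod_mul hXω.aemeasurable hYω.aemeasurable]
  rcases le_total (∫⁻ s in I, ‖X s ω‖ₑ) (∫⁻ s in I, ‖Y s ω‖ₑ) with hle | hle
  · calc _ ≤ (∫⁻ s in I, ‖Y s ω‖ₑ) * (∫⁻ s in I, ‖Y s ω‖ₑ) := by gcongr
      _ ≤ _ := by rw [← sq]; exact le_add_self
  · calc _ ≤ (∫⁻ s in I, ‖X s ω‖ₑ) * (∫⁻ s in I, ‖X s ω‖ₑ) := by gcongr
      _ ≤ _ := by rw [← sq]; exact le_self_add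

end TimeIntegrals

/-! ### Linear growth of the quadratic variance -/

section SpectralLowerBound

variable {ρ : Measure ℝ}

/-- Cut `A` into cells of length `1/T`. Their squares lie in the strip around the diagonal, and
Cauchy-Schwarz over the `N` cells gives the bound; `N ≤ (R + 1)T` uses `T ≥ 1`. -/
theorem sq_measureReal_div_le_prod_near_diag [IsProbabilityMeasure ρ] {A : Set ℝ}
    (hA : MeasurableSet A) {a R T : ℝ} (hT : 1 ≤ T) (hAR : ∀ x ∈ A, a ≤ x ∧ x ≤ a + R)
    (hR : 0 ≤ R) :
    ρ.real A ^ 2 / ((R + 1) * T) ≤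
      (ρ.prod ρ).real {x | x.1 ∈ A ∧ x.2 ∈ A ∧ |x.1 - x.2| ≤ 1 / T} := by
  have hT0 : 0 < T := by linarith
  set N := ⌊R * T⌋₊ + 1 with hN
  set B : ℕ → Set ℝ := fun j => A ∩ (fun x => ⌊(x - a) * T⌋₊) ⁻¹' {j} with hB
  have hBm : ∀ j, MeasurableSet (B j) := fun j =>
    hA.inter ((Nat.measurable_floor.comp (by fun_prop : Measurable fun x : ℝ => (x - a) * T))
      (measurableSet_singleton j))
  have hdisj : ∀ i j, i ≠ j → Disjoint (B i) (B j) := by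
    intro i j hij
    rw [Set.disjoint_left]
    rintro x ⟨_, hi⟩ ⟨_, hj⟩
    simp only [Set.mem_preimage, Set.mem_singleton_iff] at hi hj
    exact hij (hi.symm.trans hj)
  have hUnion : A = ⋃ j ∈ Finset.range N, B j := by
    ext x
    simp only [Set.mem_iUnion, Finset.mem_range]
    constructor
    · intro hx
      refine ⟨⌊(x - a) * T⌋₊, ?_, hx, rfl⟩
      rw [hN, Nat.lt_succ_iff]
      refine Nat.floor_mono (mul_le_mul_of_nonneg_right ?_ hT0.le)
      linarith [(hAR x hx).2]
    · rintro ⟨j, _, hx, _⟩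
      exact hx
  have hsum : ρ.real A = ∑ j ∈ Finset.range N, ρ.real (B j) := by
    conv_lhs => rw [hUnion]
    exact measureReal_biUnion_finset (fun i _ j _ hij => hdisj i j hij) fun j _ => hBm j
  have hcs : ρ.real A ^ 2 ≤ N * ∑ j ∈ Finset.range N, ρ.real (B j) ^ 2 := by
    rw [hsum]
    simpa using sq_sum_le_card_mul_sum_sq (s := Finset.range N) (f := fun j => ρ.real (B j))
  have hN' : (N : ℝ) ≤ (R + 1) * T := by
    have := Nat.floor_le (show 0 ≤ R * T by positivity)
    rw [hN]; push_cast
    linarith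
  have hprod : ∑ j ∈ Finset.range N, ρ.real (B j) ^ 2 ≤
      (ρ.prod ρ).real {x | x.1 ∈ A ∧ x.2 ∈ A ∧ |x.1 - x.2| ≤ 1 / T} := by
    have e : ∀ j, ρ.real (B j) ^ 2 = (ρ.prod ρ).real (B j ×ˢ B j) := by
      intro j; rw [measureReal_prod_prod, sq]
    simp only [e]
    rw [← measureReal_biUnion_finset (fun i _ j _ hij => ?_)
      fun j _ => (hBm j).prod (hBm j)]
    · refine measureReal_mono (fun x hx => ?_)
      simp only [Set.mem_iUnion] at hx
      obtain ⟨j, _, ⟨hx1, hj1⟩, hx2, hj2⟩ := hx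
      refine ⟨hx1, hx2, ?_⟩
      simp only [Set.mem_preimage, Set.mem_singleton_iff] at hj1 hj2
      have p1 : 0 ≤ (x.1 - a) * T := mul_nonneg (by linarith [(hAR _ hx1).1]) hT0.le
      have p2 : 0 ≤ (x.2 - a) * T := mul_nonneg (by linarith [(hAR _ hx2).1]) hT0.le
      obtain ⟨l1, u1⟩ := (Nat.floor_eq_iff p1).1 hj1
      obtain ⟨l2, u2⟩ := (Nat.floor_eq_iff p2).1 hj2
      have habs : |x.1 - x.2| * T = |(x.1 - x.2) * T| := by rw [abs_mul, abs_of_pos hT0]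
      rw [le_div_iff₀ hT0, habs, abs_le]
      constructor <;> nlinarith
    · exact Set.disjoint_prod.2 (Or.inl (hdisj i j hij))
  have hNpos : (0 : ℝ) < (R + 1) * T := by positivity
  rw [div_le_iff₀ hNpos]
  have h0 : 0 ≤ ∑ j ∈ Finset.range N, ρ.real (B j) ^ 2 :=
    Finset.sum_nonneg fun j _ => sq_nonneg _
  calc ρ.real A ^ 2 ≤ N * ∑ j ∈ Finset.range N, ρ.real (B j) ^ 2 := hcs
    _ ≤ ((R + 1) * T) * ∑ j ∈ Finset.range N, ρ.real (B j) ^ 2 := by gcongr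
    _ ≤ ((R + 1) * T) * _ := by gcongr
    _ = _ := mul_comm _ _

/-- The time average `∫_{[0,T]²} cos (x (s - t))`. -/
noncomputable def cosKernel (T x : ℝ) : ℝ :=
  ∫ y : ℝ × ℝ, Real.cos (x * (y.1 - y.2))
    ∂((volume.restrict (Set.Ioc 0 T)).prod (volume.restrict (Set.Ioc 0 T)))

/-- The double integral is `|∫₀ᵀ exp(ixs) ds|²`, which makes its nonnegativity visible. -/
theorem cosKernel_eq (T x : ℝ) :
    cosKernel T x = (∫ s in Set.Ioc 0 T, Real.cos (x * s)) ^ 2 +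
      (∫ s in Set.Ioc 0 T, Real.sin (x * s)) ^ 2 := by
  have hc : Integrable (fun s => Real.cos (x * s)) (volume.restrict (Set.Ioc 0 T)) :=
    Integrable.of_bound (Continuous.aestronglyMeasurable (by fun_prop)) 1
      (Filter.Eventually.of_forall fun s => by simpa using Real.abs_cos_le_one _)
  have hs : Integrable (fun s => Real.sin (x * s)) (volume.restrict (Set.Ioc 0 T)) :=
    Integrable.of_bound (Continuous.aestronglyMeasurable (by fun_prop)) 1
      (Filter.Eventually.of_forall fun s => by simpa using Real.abs_sin_le_one _)
  have e : ∀ y : ℝ × ℝ, Real.cos (x * (y.1 - y.2)) =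
      Real.cos (x * y.1) * Real.cos (x * y.2) + Real.sin (x * y.1) * Real.sin (x * y.2) := by
    intro y; rw [mul_sub, Real.cos_sub]
  simp only [cosKernel, e]
  rw [integral_add (hc.mul_prod hc) (hs.mul_prod hs),
    integral_prod_mul (fun s => Real.cos (x * s)) (fun s => Real.cos (x * s)),
    integral_prod_mul (fun s => Real.sin (x * s)) (fun s => Real.sin (x * s)), sq, sq]

theorem cosKernel_nonneg (T x : ℝ) : 0 ≤ cosKernel T x := by
  rw [cosKernel_eq]; positivity

theorem sq_div_four_le_cosKernel {T x : ℝ} (hT : 0 < T) (hx : |x| ≤ 1 / T) :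
    T ^ 2 / 4 ≤ cosKernel T x := by
  have hc : Integrable (fun s => Real.cos (x * s)) (volume.restrict (Set.Ioc 0 T)) :=
    Integrable.of_bound (Continuous.aestronglyMeasurable (by fun_prop)) 1
      (Filter.Eventually.of_forall fun s => by simpa using Real.abs_cos_le_one _)
  have h : T / 2 ≤ ∫ s in Set.Ioc 0 T, Real.cos (x * s) := by
    have e : T / 2 = ∫ _ in Set.Ioc 0 T, (1 / 2 : ℝ) := by
      rw [setIntegral_const]
      simp [hT.le]
      ring
    rw [e]
    refine setIntegral_mono_on (integrableOn_const (by simp)) hc measurableSet_Ioc fun s hs => ?_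
    have h1 : |x * s| ≤ 1 := by
      rw [abs_mul, abs_of_pos hs.1]
      calc |x| * s ≤ 1 / T * T := mul_le_mul hx hs.2 hs.1.le (by positivity)
        _ = 1 := by field_simp
    have h2 : (x * s) ^ 2 ≤ 1 := by
      rw [← sq_abs]; exact pow_le_one₀ (abs_nonneg _) h1
    linarith [Real.one_sub_sq_div_two_le_cos (x := x * s)]
  rw [cosKernel_eq]
  nlinarith [sq_nonneg (∫ s in Set.Ioc 0 T, Real.sin (x * s))]

theorem integrable_quadratic_prod [IsProbabilityMeasure ρ] (hρ : MemLp (fun l : ℝ => l) 2 ρ)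
    (φ : ℝ) : Integrable (fun x : ℝ × ℝ => (x.1 + x.2 - 2 * φ) ^ 2) (ρ.prod ρ) := by
  have h1 : MemLp (fun x : ℝ × ℝ => x.1) 2 (ρ.prod ρ) := hρ.comp_fst ρ
  have h2 : MemLp (fun x : ℝ × ℝ => x.2) 2 (ρ.prod ρ) := hρ.comp_snd ρ
  exact ((h1.add h2).sub (memLp_const (2 * φ))).integrable_sq

/-- The covariance kernel of the quadratic functional `Im ((f' + iφf) * conj f)`. -/
noncomputable def quadraticKernel (ρ : Measure ℝ) (φ τ : ℝ) : ℝ :=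
  (∫ x : ℝ × ℝ, (x.1 + x.2 - 2 * φ) ^ 2 * Real.cos ((x.1 - x.2) * τ) ∂(ρ.prod ρ)) / 4

theorem integral_quadraticKernel [IsProbabilityMeasure ρ] (hρ : MemLp (fun l : ℝ => l) 2 ρ)
    (φ T : ℝ) :
    ∫ y : ℝ × ℝ, quadraticKernel ρ φ (y.1 - y.2)
      ∂((volume.restrict (Set.Ioc 0 T)).prod (volume.restrict (Set.Ioc 0 T))) =
    (∫ x : ℝ × ℝ, (x.1 + x.2 - 2 * φ) ^ 2 * cosKernel T (x.1 - x.2) ∂(ρ.prod ρ)) / 4 := by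
  simp only [quadraticKernel]
  rw [integral_div]
  congr 1
  rw [integral_integral_swap]
  · refine integral_congr_ae (Filter.Eventually.of_forall fun x => ?_)
    simp only
    rw [integral_const_mul, cosKernel]
  · refine ((integrable_quadratic_prod hρ φ).comp_snd
      ((volume.restrict (Set.Ioc 0 T)).prod (volume.restrict (Set.Ioc 0 T)))).mono'
      (Continuous.aestronglyMeasurable (by fun_prop)) (Filter.Eventually.of_forall fun x => ?_)
    simp only [Function.uncurry]
    rw [norm_mul, Real.norm_of_nonneg (sq_nonneg _), Real.norm_eq_abs]
    exact mul_le_of_le_one_right (sq_nonneg _) (Real.abs_cos_le_one _)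

theorem exists_linear_le_integral_quadraticKernel [IsProbabilityMeasure ρ]
    (hρ : MemLp (fun l : ℝ => l) 2 ρ) (hdeg : ¬ IsDegenerate ρ) (φ : ℝ) :
    ∃ C > 0, ∀ T : ℝ, 1 ≤ T → C * T ≤ ∫ y : ℝ × ℝ, quadraticKernel ρ φ (y.1 - y.2)
      ∂((volume.restrict (Set.Ioc 0 T)).prod (volume.restrict (Set.Ioc 0 T))) := by
  have h0 : ρ {x | x - φ ≠ 0} ≠ 0 := by
    intro h
    refine hdeg ⟨φ, eq_dirac_of_compl_singleton (measure_mono_null (fun x hx => ?_) h)⟩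
    exact sub_ne_zero.2 hx
  obtain ⟨n, hn, hB⟩ := exists_pos_measure_annulus h0
  have hn' : (0 : ℝ) < n := by exact_mod_cast hn
  have hninv : (n : ℝ)⁻¹ ≤ n := by
    have : (1 : ℝ) ≤ n := by exact_mod_cast hn
    exact (inv_le_one_of_one_le₀ this).trans this
  obtain ⟨A, hA, hApos, ⟨a, haR⟩, hA2⟩ : ∃ A : Set ℝ, MeasurableSet A ∧ ρ A ≠ 0 ∧
      (∃ a, ∀ x ∈ A, a ≤ x ∧ x ≤ a + n) ∧
      ∀ x ∈ A, ∀ y ∈ A, 4 * (n : ℝ)⁻¹ ^ 2 ≤ (x + y - 2 * φ) ^ 2 := by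
    have hsplit : {x | (n : ℝ)⁻¹ ≤ |x - φ| ∧ |x - φ| ≤ n} ⊆
        Set.Icc (φ + (n : ℝ)⁻¹) (φ + n) ∪ Set.Icc (φ - n) (φ - (n : ℝ)⁻¹) := by
      rintro x ⟨h1, h2⟩
      rcases le_total 0 (x - φ) with h | h
      · rw [abs_of_nonneg h] at h1 h2
        exact Or.inl ⟨by linarith, by linarith⟩
      · rw [abs_of_nonpos h] at h1 h2
        exact Or.inr ⟨by linarith, by linarith⟩
    have hinv : 0 < (n : ℝ)⁻¹ := inv_pos.2 hn'
    -- Keeping `A` on one side of `φ` prevents `x - φ` and `y - φ` from cancelling in `x + y - 2φ`.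
    by_cases hp : ρ (Set.Icc (φ + (n : ℝ)⁻¹) (φ + n)) = 0
    · refine ⟨Set.Icc (φ - n) (φ - (n : ℝ)⁻¹), measurableSet_Icc, fun hm => ?_,
        ⟨φ - n, fun x hx => ⟨hx.1, by linarith [hx.2]⟩⟩, fun x hx y hy => ?_⟩
      · exact hB (measure_mono_null hsplit (measure_union_null hp hm))
      · nlinarith [hx.2, hy.2]
    · refine ⟨Set.Icc (φ + (n : ℝ)⁻¹) (φ + n), measurableSet_Icc, hp,
        ⟨φ, fun x hx => ⟨by linarith [hx.1], hx.2⟩⟩, fun x hx y hy => ?_⟩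
      nlinarith [hx.1, hy.1]
  have hAreal : 0 < ρ.real A := ENNReal.toReal_pos hApos (measure_ne_top _ _)
  -- The constant collects `4 n⁻²` from the quadratic factor, `T²/4` from the kernel, the strip mass
  -- `ρ(A)² / ((n + 1)T)`, and the `1/4` in `quadraticKernel`.
  refine ⟨(n : ℝ)⁻¹ ^ 2 / 4 * (ρ.real A ^ 2 / (n + 1)), by positivity, fun T hT => ?_⟩
  have hT0 : 0 < T := by linarith
  rw [integral_quadraticKernel hρ]
  set D : Set (ℝ × ℝ) := {x | x.1 ∈ A ∧ x.2 ∈ A ∧ |x.1 - x.2| ≤ 1 / T} with hD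
  have hDm : MeasurableSet D :=
    (measurable_fst hA).inter ((measurable_snd hA).inter
      ((measurable_fst.sub measurable_snd).abs (measurableSet_Iic (a := 1 / T))))
  have hdiag := sq_measureReal_div_le_prod_near_diag (ρ := ρ) hA hT haR hn'.le
  have hint : Integrable (fun x : ℝ × ℝ => (x.1 + x.2 - 2 * φ) ^ 2 * cosKernel T (x.1 - x.2))
      (ρ.prod ρ) := by
    have hcont : AEStronglyMeasurable (fun x : ℝ × ℝ => cosKernel T (x.1 - x.2)) (ρ.prod ρ) := by
      unfold cosKernel
      have : StronglyMeasurable fun z : (ℝ × ℝ) × (ℝ × ℝ) =>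
          Real.cos ((z.1.1 - z.1.2) * (z.2.1 - z.2.2)) :=
        Continuous.stronglyMeasurable (by fun_prop)
      exact this.integral_prod_right'.aestronglyMeasurable
    refine (integrable_quadratic_prod hρ φ).mul_bdd (c := T * T) hcont
      (Filter.Eventually.of_forall fun x => ?_)
    refine (norm_integral_le_of_norm_le_const (C := 1) (Filter.Eventually.of_forall fun y => by
      simpa using Real.abs_cos_le_one _)).trans ?_
    rw [one_mul, ← Set.univ_prod_univ, measureReal_prod_prod]
    simp [hT0.le]
  have hlow : (n : ℝ)⁻¹ ^ 2 * T ^ 2 * (ρ.prod ρ).real D ≤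
      ∫ x : ℝ × ℝ, (x.1 + x.2 - 2 * φ) ^ 2 * cosKernel T (x.1 - x.2) ∂(ρ.prod ρ) := by
    have e : (n : ℝ)⁻¹ ^ 2 * T ^ 2 * (ρ.prod ρ).real D =
        ∫ _ in D, (n : ℝ)⁻¹ ^ 2 * T ^ 2 ∂(ρ.prod ρ) := by
      rw [setIntegral_const, smul_eq_mul]; ring
    rw [e]
    refine le_trans (setIntegral_mono_on (integrable_const _).integrableOn hint.integrableOn hDm
      fun x hx => ?_) (setIntegral_le_integral hint
        (Filter.Eventually.of_forall fun x => mul_nonneg (sq_nonneg _) (cosKernel_nonneg _ _)))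
    have h1 := hA2 _ hx.1 _ hx.2.1
    have h2 := sq_div_four_le_cosKernel hT0 hx.2.2
    calc (n : ℝ)⁻¹ ^ 2 * T ^ 2 = 4 * (n : ℝ)⁻¹ ^ 2 * (T ^ 2 / 4) := by ring
      _ ≤ _ := mul_le_mul h1 h2 (by positivity) (sq_nonneg _)
  rw [le_div_iff₀ (by norm_num)]
  refine le_trans ?_ hlow
  calc (n : ℝ)⁻¹ ^ 2 / 4 * (ρ.real A ^ 2 / (n + 1)) * T * 4
      = (n : ℝ)⁻¹ ^ 2 * T ^ 2 * (ρ.real A ^ 2 / ((n + 1) * T)) := by field_simp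
    _ ≤ _ := by gcongr

end SpectralLowerBound

/-! ### Spectral formulas for the covariances -/

section SpectralIdentities

variable {ρ : Measure ℝ}

/-- The spectral representative of `f' + iφf` at time `t`. -/
noncomputable def spectralDeriv (φ t l : ℝ) : ℂ := -Complex.I * (l - φ) * spectralExp t l

theorem spectralExp_mul_conj (s t l : ℝ) :
    spectralExp s l * conj (spectralExp t l) = spectralExp (s - t) l := by
  rw [conj_spectralExp, ← spectralExp_add, sub_eq_add_neg]

theorem integral_norm_spectralExp_sq [IsProbabilityMeasure ρ] (t : ℝ) :
    ∫ l, ‖spectralExp t l‖ ^ 2 ∂ρ = 1 := by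
  simp [norm_spectralExp]

theorem integral_norm_spectralDeriv_sq (φ t : ℝ) :
    ∫ l, ‖spectralDeriv φ t l‖ ^ 2 ∂ρ = ∫ l, (l - φ) ^ 2 ∂ρ := by
  refine integral_congr_ae (Filter.Eventually.of_forall fun l => ?_)
  simp only [spectralDeriv, norm_mul, norm_spectralExp, norm_neg, Complex.norm_I, one_mul, mul_one]
  rw [← Complex.ofReal_sub, Complex.norm_real, Real.norm_eq_abs, sq_abs]

/-- Centring at the mean frequency is what makes `f' + iφf` orthogonal to `f` at the same time. -/
theorem integral_spectralDeriv_mul_conj_self [IsProbabilityMeasure ρ]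
    (hρ : MemLp (fun l : ℝ => l) 2 ρ) (t : ℝ) :
    ∫ l, spectralDeriv (∫ l, l ∂ρ) t l * conj (spectralExp t l) ∂ρ = 0 := by
  have h : ∀ l, spectralDeriv (∫ l, l ∂ρ) t l * conj (spectralExp t l) =
      -Complex.I * ((l - ∫ l, l ∂ρ : ℝ) : ℂ) := by
    intro l
    rw [spectralDeriv, mul_assoc, spectralExp_mul_conj]
    simp [spectralExp]
  have hi : Integrable (fun l : ℝ => l) ρ := hρ.integrable (by norm_num)
  simp only [h]
  rw [integral_const_mul, integral_complex_ofReal, integral_sub hi (integrable_const _)]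
  simp

/-- The Wick expression is a double spectral integral with weight `(y - φ)² + (x - φ)(y - φ)`. The
cosine is symmetric under exchanging `x` and `y`, so the weight may be replaced by half of the
perfect square `(x + y - 2φ)²`. -/
theorem quadraticKernel_eq [IsProbabilityMeasure ρ] (hρ : MemLp (fun l : ℝ => l) 2 ρ)
    (φ s t : ℝ) :
    ((∫ l, spectralExp t l * conj (spectralExp s l) ∂ρ) *
        (∫ l, spectralDeriv φ s l * conj (spectralDeriv φ t l) ∂ρ) -
      (∫ l, spectralDeriv φ t l * conj (spectralExp s l) ∂ρ) *
        ∫ l, spectralDeriv φ s l * conj (spectralExp t l) ∂ρ).re / 2 =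
      quadraticKernel ρ φ (s - t) := by
  have h1 : MemLp (fun x : ℝ × ℝ => x.1 - φ) 2 (ρ.prod ρ) :=
    (hρ.comp_fst ρ).sub (memLp_const φ)
  have h2 : MemLp (fun x : ℝ × ℝ => x.2 - φ) 2 (ρ.prod ρ) :=
    (hρ.comp_snd ρ).sub (memLp_const φ)
  have i1 : Integrable (fun x : ℝ × ℝ => (x.1 - φ) ^ 2) (ρ.prod ρ) := h1.integrable_sq
  have i2 : Integrable (fun x : ℝ × ℝ => (x.2 - φ) ^ 2) (ρ.prod ρ) := h2.integrable_sq
  have i12 : Integrable (fun x : ℝ × ℝ => (x.1 - φ) * (x.2 - φ)) (ρ.prod ρ) :=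
    h1.integrable_mul h2
  have bdd : ∀ {g : ℝ × ℝ → ℝ}, Integrable g (ρ.prod ρ) →
      Integrable (fun x => g x * Real.cos ((x.1 - x.2) * (s - t))) (ρ.prod ρ) := fun hg =>
    hg.mul_bdd (c := 1) (Continuous.aestronglyMeasurable (by fun_prop))
      (Filter.Eventually.of_forall fun x => by simpa using Real.abs_cos_le_one _)
  have bddE : ∀ {g : ℝ × ℝ → ℝ}, Integrable g (ρ.prod ρ) →
      Integrable (fun x => (g x : ℂ) *
        Complex.exp (((x.1 - x.2) * (s - t) : ℝ) * Complex.I)) (ρ.prod ρ) := fun hg =>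
    hg.ofReal.mul_bdd (c := 1) (Continuous.aestronglyMeasurable (by fun_prop))
      (Filter.Eventually.of_forall fun x => by rw [Complex.norm_exp_ofReal_mul_I])
  have reE : ∀ {g : ℝ × ℝ → ℝ}, Integrable g (ρ.prod ρ) →
      (∫ x, (g x : ℂ) * Complex.exp (((x.1 - x.2) * (s - t) : ℝ) * Complex.I) ∂(ρ.prod ρ)).re =
        ∫ x, g x * Real.cos ((x.1 - x.2) * (s - t)) ∂(ρ.prod ρ) := by
    intro g hg
    refine (integral_re (bddE hg)).symm.trans
      (integral_congr_ae (Filter.Eventually.of_forall fun x => ?_))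
    simp only [RCLike.re_eq_complex_re]
    rw [Complex.re_ofReal_mul, Complex.exp_ofReal_mul_I_re]
  have phase : ∀ x y : ℝ, spectralExp t x * conj (spectralExp s x) *
      (spectralExp s y * conj (spectralExp t y)) =
        Complex.exp (((x - y) * (s - t) : ℝ) * Complex.I) := by
    intro x y
    rw [spectralExp_mul_conj, spectralExp_mul_conj, spectralExp, spectralExp, ← Complex.exp_add]
    congr 1; push_cast; ring
  have e1 : (∫ l, spectralExp t l * conj (spectralExp s l) ∂ρ) *
        (∫ l, spectralDeriv φ s l * conj (spectralDeriv φ t l) ∂ρ) =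
      ∫ x : ℝ × ℝ, (((x.2 - φ) ^ 2 : ℝ) : ℂ) *
        Complex.exp (((x.1 - x.2) * (s - t) : ℝ) * Complex.I) ∂(ρ.prod ρ) := by
    rw [← integral_prod_mul]
    refine integral_congr_ae (Filter.Eventually.of_forall fun x => ?_)
    simp only
    rw [← phase]
    simp only [spectralDeriv, map_mul, map_neg, Complex.conj_I, map_sub, Complex.conj_ofReal]
    push_cast
    linear_combination (-(x.2 - φ : ℂ) ^ 2 * (spectralExp t x.1 * conj (spectralExp s x.1) *
      (spectralExp s x.2 * conj (spectralExp t x.2)))) * Complex.I_sq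
  have e2 : (∫ l, spectralDeriv φ t l * conj (spectralExp s l) ∂ρ) *
        (∫ l, spectralDeriv φ s l * conj (spectralExp t l) ∂ρ) =
      ∫ x : ℝ × ℝ, -((((x.1 - φ) * (x.2 - φ) : ℝ) : ℂ) *
        Complex.exp (((x.1 - x.2) * (s - t) : ℝ) * Complex.I)) ∂(ρ.prod ρ) := by
    rw [← integral_prod_mul]
    refine integral_congr_ae (Filter.Eventually.of_forall fun x => ?_)
    simp only
    rw [← phase]
    simp only [spectralDeriv]
    push_cast
    linear_combination ((x.1 - φ : ℂ) * (x.2 - φ) * (spectralExp t x.1 * conj (spectralExp s x.1) *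
      (spectralExp s x.2 * conj (spectralExp t x.2)))) * Complex.I_sq
  rw [e1, e2, integral_neg, sub_neg_eq_add, Complex.add_re, reE i2, reE i12]
  have hswap : ∫ x : ℝ × ℝ, (x.2 - φ) ^ 2 * Real.cos ((x.1 - x.2) * (s - t)) ∂(ρ.prod ρ) =
      ∫ x : ℝ × ℝ, (x.1 - φ) ^ 2 * Real.cos ((x.1 - x.2) * (s - t)) ∂(ρ.prod ρ) := by
    rw [← integral_prod_swap]
    refine integral_congr_ae (Filter.Eventually.of_forall fun x => ?_)
    simp only [Prod.fst_swap, Prod.snd_swap]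
    rw [← Real.cos_neg]
    ring_nf
  have hsum : ∫ x : ℝ × ℝ, (x.1 + x.2 - 2 * φ) ^ 2 * Real.cos ((x.1 - x.2) * (s - t))
        ∂(ρ.prod ρ) =
      ∫ x : ℝ × ℝ, (x.1 - φ) ^ 2 * Real.cos ((x.1 - x.2) * (s - t)) ∂(ρ.prod ρ) +
      ∫ x : ℝ × ℝ, (x.2 - φ) ^ 2 * Real.cos ((x.1 - x.2) * (s - t)) ∂(ρ.prod ρ) +
      2 * ∫ x : ℝ × ℝ, (x.1 - φ) * (x.2 - φ) * Real.cos ((x.1 - x.2) * (s - t)) ∂(ρ.prod ρ) := by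
    rw [← integral_const_mul, ← integral_add (bdd i1) (bdd i2)]
    have i3 : Integrable (fun x : ℝ × ℝ => (x.1 - φ) ^ 2 * Real.cos ((x.1 - x.2) * (s - t)) +
      (x.2 - φ) ^ 2 * Real.cos ((x.1 - x.2) * (s - t))) (ρ.prod ρ) := (bdd i1).add (bdd i2)
    rw [← integral_add i3 ((bdd i12).const_mul 2)]
    refine integral_congr_ae (Filter.Eventually.of_forall fun x => ?_)
    simp only
    ring
  rw [quadraticKernel, hsum, hswap]
  ring

end SpectralIdentities

/-! ### Projection of the winding onto the quadratic functional -/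

section Winding

variable {Ω E : Type*} [MeasurableSpace Ω] [MeasurableSpace E] {P : Measure Ω}

theorem IsIsonormal.integrable_im_mul_im [IsProbabilityMeasure P] {ρ : Measure E}
    {S : Submodule ℂ ((Ω → ℂ) × (E → ℂ))} (hS : IsIsonormal P ρ S) {N : ℂ → ℂ}
    (hN : IsDualFactor N)
    {z w u v : (Ω → ℂ) × (E → ℂ)} (hz : z ∈ S) (hw : w ∈ S) (hu : u ∈ S) (hv : v ∈ S)
    (hz1 : ∫ x, ‖z.2 x‖ ^ 2 ∂ρ = 1) (hwz : ∫ x, w.2 x * conj (z.2 x) ∂ρ = 0) :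
    Integrable (fun ω => (N (z.1 ω) * w.1 ω).im * (v.1 ω * conj (u.1 ω)).im) P := by
  have h1 := (hS.dualFactor_wick hN hz hw hu hv hz1 hwz).1
  have h2 := (hS.dualFactor_wick hN hz hw hv hu hz1 hwz).1
  simp only [im_mul_im, map_mul, Complex.conj_conj]
  have e : ∀ ω, N (z.1 ω) * w.1 ω * (conj (v.1 ω) * u.1 ω) =
      N (z.1 ω) * w.1 ω * (u.1 ω * conj (v.1 ω)) := fun ω => by ring
  simp only [e]
  exact (h2.sub h1).re.div_const 2

variable {f : ℝ → Ω → ℂ} {ρ : Measure ℝ}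

/-- The derivative of the demodulated process `exp (iφt) f t`, up to the phase factor. -/
noncomputable def centredDeriv (f : ℝ → Ω → ℂ) (φ t : ℝ) (ω : Ω) : ℂ :=
  deriv (fun s => f s ω) t + Complex.I * φ * f t ω

theorem process_mem_dominatedClosure (hS : IsIsonormal P ρ (processSpan f)) (t : ℝ) :
    ((f t, spectralExp t) : (Ω → ℂ) × (ℝ → ℂ)) ∈ dominatedClosure P ρ (processSpan f) :=
  hS.le_dominatedClosure (Submodule.subset_span ⟨t, rfl⟩)

theorem centredDeriv_mem_dominatedClosure (hS : IsIsonormal P ρ (processSpan f))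
    (hρ : MemLp (fun l : ℝ => l) 2 ρ) (hd : ∀ᵐ ω ∂P, ContDiff ℝ 1 (fun t => f t ω))
    (φ t : ℝ) :
    ((centredDeriv f φ t, spectralDeriv φ t) : (Ω → ℂ) × (ℝ → ℂ)) ∈
      dominatedClosure P ρ (processSpan f) := by
  have h := Submodule.add_mem _ (deriv_mem_dominatedClosure hρ hd t)
    (Submodule.smul_mem _ (Complex.I * φ) (process_mem_dominatedClosure hS t))
  convert h using 1
  refine Prod.ext ?_ ?_
  · ext ω; simp [centredDeriv]
  · ext l; simp [spectralDeriv]; ring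

/-- The instantaneous angular velocity of the path. -/
noncomputable def angularVelocity (f : ℝ → Ω → ℂ) (t : ℝ) (ω : Ω) : ℝ :=
  (deriv (fun s => f s ω) t / f t ω).im

/-- The quadratic projection of the angular velocity. -/
noncomputable def quadraticVelocity (f : ℝ → Ω → ℂ) (φ t : ℝ) (ω : Ω) : ℝ :=
  (centredDeriv f φ t ω * conj (f t ω)).im

theorem measurable_angularVelocity (hm : ∀ t, Measurable (f t))
    (hd : ∀ ω, ContDiff ℝ 1 (fun t => f t ω)) :
    Measurable (Function.uncurry (angularVelocity f)) :=
  Complex.measurable_im.comp ((measurable_uncurry_deriv_of_contDiff hm hd).div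
    (measurable_uncurry_of_contDiff hm hd))

theorem measurable_quadraticVelocity (hm : ∀ t, Measurable (f t))
    (hd : ∀ ω, ContDiff ℝ 1 (fun t => f t ω)) (φ : ℝ) :
    Measurable (Function.uncurry (quadraticVelocity f φ)) := by
  have h1 := measurable_uncurry_deriv_of_contDiff hm hd
  have h2 := measurable_uncurry_of_contDiff hm hd
  exact Complex.measurable_im.comp ((h1.add (h2.const_mul _)).mul
    (Complex.continuous_conj.measurable.comp h2))

theorem lintegral_sq_angularVelocity_lt_top [IsProbabilityMeasure P] [IsProbabilityMeasure ρ]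
    (hS : IsIsonormal P ρ (processSpan f)) (hρ : MemLp (fun l : ℝ => l) 2 ρ)
    (hdeg : ¬ IsDegenerate ρ) (hm : ∀ t, Measurable (f t))
    (hd : ∀ ω, ContDiff ℝ 1 (fun t => f t ω)) (T : ℝ) :
    ∫⁻ ω, (∫⁻ s in Set.Ioc 0 T, ‖angularVelocity f s ω‖ₑ) ^ 2 ∂P < ⊤ := by
  obtain ⟨κ, hκ, τ, hτ, hκτ⟩ := exists_one_sub_norm_sq_ge hdeg
  -- The two-point estimate is used with `β = √κ |s - t|` and with `φ = 0`, for which `centredDeriv`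
  -- is the plain derivative.
  refine lintegral_sq_Ioc_lt_top (measurable_angularVelocity hm hd) hτ (q := -(3 / 5))
    (by norm_num) (A := twoPointConst (∫ l, (l - 0) ^ 2 ∂ρ))
    (B := 4 * negMomentConst * Real.sqrt κ ^ (-(3 / 5) : ℝ)) (fun s t hst hstτ => ?_) T
  have hd' : ∀ᵐ ω ∂P, ContDiff ℝ 1 (fun t => f t ω) := Filter.Eventually.of_forall hd
  have hpos : 0 < |s - t| := abs_pos.2 (sub_ne_zero.2 hst)
  have hκs := Real.sqrt_pos.2 hκ
  have hβ : (Real.sqrt κ * |s - t|) ^ 2 ≤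
      1 - ‖∫ l, spectralExp t l * conj (spectralExp s l) ∂ρ‖ ^ 2 := by
    simp only [spectralExp_mul_conj]
    rw [mul_pow, Real.sq_sqrt hκ.le, sq_abs]
    have := hκτ (t - s) (by rwa [abs_sub_comm])
    rwa [sub_sq_comm] at this
  have h := (hS.dominatedClosure).lintegral_two_point_le
    (process_mem_dominatedClosure hS s) (process_mem_dominatedClosure hS t)
    (centredDeriv_mem_dominatedClosure hS hρ hd' 0 s)
    (centredDeriv_mem_dominatedClosure hS hρ hd' 0 t)
    (integral_norm_spectralExp_sq s) (integral_norm_spectralExp_sq t)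
    (integral_norm_spectralDeriv_sq 0 s) (integral_norm_spectralDeriv_sq 0 t)
    (mul_pos hκs hpos) hβ
  have hle : ∀ u ω, ‖angularVelocity f u ω‖ₑ ≤ ‖centredDeriv f 0 u ω / f u ω‖ₑ := by
    intro u ω
    rw [enorm_le_iff_norm_le]
    simpa [angularVelocity, centredDeriv] using
      Complex.abs_im_le_norm (deriv (fun s => f s ω) u / f u ω)
  refine (lintegral_mono fun ω => mul_le_mul' (hle s ω) (hle t ω)).trans (h.trans_eq ?_)
  rw [Real.mul_rpow hκs.le hpos.le, ← mul_assoc]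

theorem mul_four_le (a b c d : ℝ) :
    a * b * (c * d) ≤ (a ^ 4 + b ^ 4) + (c ^ 4 + d ^ 4) := by
  nlinarith [sq_nonneg (a * b - c * d), sq_nonneg (a ^ 2 - b ^ 2), sq_nonneg (c ^ 2 - d ^ 2),
    sq_nonneg (a ^ 2), sq_nonneg (b ^ 2), sq_nonneg (c ^ 2), sq_nonneg (d ^ 2)]

theorem lintegral_sq_quadraticVelocity_lt_top [IsProbabilityMeasure P] [IsProbabilityMeasure ρ]
    (hS : IsIsonormal P ρ (processSpan f)) (hρ : MemLp (fun l : ℝ => l) 2 ρ)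
    (hm : ∀ t, Measurable (f t)) (hd : ∀ ω, ContDiff ℝ 1 (fun t => f t ω)) (φ T : ℝ) :
    ∫⁻ ω, (∫⁻ s in Set.Ioc 0 T, ‖quadraticVelocity f φ s ω‖ₑ) ^ 2 ∂P < ⊤ := by
  have hd' : ∀ᵐ ω ∂P, ContDiff ℝ 1 (fun t => f t ω) := Filter.Eventually.of_forall hd
  have hC := hS.dominatedClosure
  have hz := fun t => hC.integrable_norm_rpow (process_mem_dominatedClosure hS t) (q := 4)
    (by norm_num)
  have hw := fun t => hC.integrable_norm_rpow
    (centredDeriv_mem_dominatedClosure hS hρ hd' φ t) (q := 4) (by norm_num)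
  simp only [integral_norm_spectralExp_sq, integral_norm_spectralDeriv_sq] at hz hw
  obtain ⟨a, ha⟩ : ∃ a, ∀ t, ∫ ω, ‖f t ω‖ ^ (4 : ℝ) ∂P = a := ⟨_, fun t => (hz t).2⟩
  obtain ⟨b, hb⟩ : ∃ b, ∀ t, ∫ ω, ‖centredDeriv f φ t ω‖ ^ (4 : ℝ) ∂P = b :=
    ⟨_, fun t => (hw t).2⟩
  -- There is no denominator here, so constant fourth moments give a bound without singularity.
  refine lintegral_sq_Ioc_lt_top (measurable_quadraticVelocity hm hd φ) one_pos (q := 0)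
    (by norm_num) (A := (b + a) + (b + a)) (B := 0) (fun s t _ _ => ?_) T
  have hI : ∀ t, Integrable (fun ω => ‖centredDeriv f φ t ω‖ ^ (4 : ℝ) + ‖f t ω‖ ^ (4 : ℝ)) P :=
    fun t => (hw t).1.add (hz t).1
  have hI2 : Integrable (fun ω => (‖centredDeriv f φ s ω‖ ^ (4 : ℝ) + ‖f s ω‖ ^ (4 : ℝ)) +
    (‖centredDeriv f φ t ω‖ ^ (4 : ℝ) + ‖f t ω‖ ^ (4 : ℝ))) P := (hI s).add (hI t)
  have hle : ∀ u ω, |quadraticVelocity f φ u ω| ≤ ‖centredDeriv f φ u ω‖ * ‖f u ω‖ := by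
    intro u ω
    refine (Complex.abs_im_le_norm _).trans ?_
    rw [norm_mul, RCLike.norm_conj]
  calc ∫⁻ ω, ‖quadraticVelocity f φ s ω‖ₑ * ‖quadraticVelocity f φ t ω‖ₑ ∂P
      ≤ ∫⁻ ω, ENNReal.ofReal ((‖centredDeriv f φ s ω‖ ^ (4 : ℝ) + ‖f s ω‖ ^ (4 : ℝ)) +
          (‖centredDeriv f φ t ω‖ ^ (4 : ℝ) + ‖f t ω‖ ^ (4 : ℝ))) ∂P := by
        refine lintegral_mono fun ω => ?_
        rw [← enorm_mul, ← ofReal_norm]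
        refine ENNReal.ofReal_le_ofReal ?_
        rw [norm_mul, Real.norm_eq_abs, Real.norm_eq_abs]
        refine (mul_le_mul (hle s ω) (hle t ω) (abs_nonneg _) (by positivity)).trans ?_
        have := mul_four_le ‖centredDeriv f φ s ω‖ ‖f s ω‖ ‖centredDeriv f φ t ω‖ ‖f t ω‖
        simp only [show (4 : ℝ) = ((4 : ℕ) : ℝ) by norm_num, Real.rpow_natCast]
        exact this
    _ = ENNReal.ofReal (∫ ω, ((‖centredDeriv f φ s ω‖ ^ (4 : ℝ) + ‖f s ω‖ ^ (4 : ℝ)) +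
          (‖centredDeriv f φ t ω‖ ^ (4 : ℝ) + ‖f t ω‖ ^ (4 : ℝ))) ∂P) :=
        (ofReal_integral_eq_lintegral_ofReal hI2
          (Filter.Eventually.of_forall fun ω => by positivity)).symm
    _ = _ := by
        rw [integral_add (hI s) (hI t), integral_add (hw s).1 (hz s).1,
          integral_add (hw t).1 (hz t).1, ha, ha, hb, hb, zero_mul, add_zero]

theorem integral_quadraticVelocity [IsProbabilityMeasure P] [IsProbabilityMeasure ρ]
    (hS : IsIsonormal P ρ (processSpan f)) (hρ : MemLp (fun l : ℝ => l) 2 ρ)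
    (hd : ∀ᵐ ω ∂P, ContDiff ℝ 1 (fun t => f t ω)) (t : ℝ) :
    Integrable (quadraticVelocity f (∫ l, l ∂ρ) t) P ∧
      ∫ ω, quadraticVelocity f (∫ l, l ∂ρ) t ω ∂P = 0 := by
  have hC := hS.dominatedClosure
  have hz := process_mem_dominatedClosure hS t
  have hw := centredDeriv_mem_dominatedClosure hS hρ hd (∫ l, l ∂ρ) t
  have hi := memLp_two_mul_conj (hC.memLp hw (q := 2) (by simp)) (hC.memLp hz (q := 2) (by simp))
  have h := hC.integral_mul_conj hw hz
  refine ⟨hi.im, (integral_im hi).trans ?_⟩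
  simp only at h
  rw [h, integral_spectralDeriv_mul_conj_self hρ]
  simp

theorem integral_quadraticVelocity_mul [IsProbabilityMeasure P] [IsProbabilityMeasure ρ]
    (hS : IsIsonormal P ρ (processSpan f)) (hρ : MemLp (fun l : ℝ => l) 2 ρ)
    (hd : ∀ᵐ ω ∂P, ContDiff ℝ 1 (fun t => f t ω)) (s t : ℝ) :
    ∫ ω, quadraticVelocity f (∫ l, l ∂ρ) s ω * quadraticVelocity f (∫ l, l ∂ρ) t ω ∂P =
      quadraticKernel ρ (∫ l, l ∂ρ) (s - t) := by
  have h := (hS.dominatedClosure).integral_im_mul_im isDualFactor_conj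
    (process_mem_dominatedClosure hS s)
    (centredDeriv_mem_dominatedClosure hS hρ hd (∫ l, l ∂ρ) s)
    (process_mem_dominatedClosure hS t)
    (centredDeriv_mem_dominatedClosure hS hρ hd (∫ l, l ∂ρ) t)
    (integral_norm_spectralExp_sq s) (integral_spectralDeriv_mul_conj_self hρ s)
  rw [quadraticKernel_eq hρ] at h
  rw [← h]
  refine integral_congr_ae (Filter.Eventually.of_forall fun ω => ?_)
  simp only [quadraticVelocity]
  rw [mul_comm (centredDeriv f _ s ω)]

/-- The value agrees with that of `integral_quadraticVelocity_mul`, because inversion and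
conjugation are both dual factors. This says that the quadratic velocity acts as the projection of
the angular velocity. -/
theorem integral_angularVelocity_mul [IsProbabilityMeasure P] [IsProbabilityMeasure ρ]
    (hS : IsIsonormal P ρ (processSpan f)) (hρ : MemLp (fun l : ℝ => l) 2 ρ)
    (hd : ∀ᵐ ω ∂P, ContDiff ℝ 1 (fun t => f t ω)) (s t : ℝ) :
    ∫ ω, angularVelocity f s ω * quadraticVelocity f (∫ l, l ∂ρ) t ω ∂P =
      quadraticKernel ρ (∫ l, l ∂ρ) (s - t) := by
  set φ := ∫ l, l ∂ρ with hφ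
  have hC := hS.dominatedClosure
  have hz := process_mem_dominatedClosure hS s
  have hw := centredDeriv_mem_dominatedClosure hS hρ hd φ s
  have hu := process_mem_dominatedClosure hS t
  have hv := centredDeriv_mem_dominatedClosure hS hρ hd φ t
  have hwz : ∫ l, spectralDeriv φ s l * conj (spectralExp s l) ∂ρ = 0 :=
    integral_spectralDeriv_mul_conj_self hρ s
  have h1 := hC.integral_im_mul_im isDualFactor_inv hz hw hu hv
    (integral_norm_spectralExp_sq s) hwz
  have h2 := hC.integrable_im_mul_im isDualFactor_inv hz hw hu hv
    (integral_norm_spectralExp_sq s) hwz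
  rw [quadraticKernel_eq hρ] at h1
  obtain ⟨h3, h4⟩ := integral_quadraticVelocity hS hρ hd t
  have hne := hC.ae_ne_zero hz (by rw [integral_norm_spectralExp_sq]; norm_num)
  -- Demodulation shifts the angular velocity by the constant `φ`, which contributes nothing because
  -- the quadratic velocity has mean zero.
  have e : (fun ω => angularVelocity f s ω * quadraticVelocity f φ t ω) =ᵐ[P] fun ω =>
      ((f s ω)⁻¹ * centredDeriv f φ s ω).im * (centredDeriv f φ t ω * conj (f t ω)).im -
        φ * quadraticVelocity f φ t ω := by
    filter_upwards [hne] with ω hω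
    have hω' : f s ω ≠ 0 := hω
    have : (f s ω)⁻¹ * centredDeriv f φ s ω =
        deriv (fun u => f u ω) s / f s ω + Complex.I * φ := by
      rw [centredDeriv]; field_simp
    rw [this, angularVelocity, quadraticVelocity]
    simp only [Complex.add_im, Complex.mul_im, Complex.I_re, Complex.I_im, Complex.ofReal_re,
      Complex.ofReal_im]
    ring
  rw [integral_congr_ae e, integral_sub h2 (h3.const_mul φ), h1, integral_const_mul, h4]
  ring

theorem memLp_winding_and_variance_ge [IsProbabilityMeasure P] [IsProbabilityMeasure ρ]
    (hS : IsIsonormal P ρ (processSpan f)) (hρ : MemLp (fun l : ℝ => l) 2 ρ)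
    (hdeg : ¬ IsDegenerate ρ) (hm : ∀ t, Measurable (f t))
    (hd : ∀ ω, ContDiff ℝ 1 (fun t => f t ω)) {T : ℝ} (hT : 0 < T) :
    MemLp (fun ω => winding (fun t => f t ω) T) 2 P ∧
      ∫ y : ℝ × ℝ, quadraticKernel ρ (∫ l, l ∂ρ) (y.1 - y.2)
        ∂((volume.restrict (Set.Ioc 0 T)).prod (volume.restrict (Set.Ioc 0 T))) ≤
        variance (fun ω => winding (fun t => f t ω) T) P := by
  set φ := ∫ l, l ∂ρ with hφ
  have hd' : ∀ᵐ ω ∂P, ContDiff ℝ 1 (fun t => f t ω) := Filter.Eventually.of_forall hd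
  have mX := measurable_angularVelocity hm hd
  have mY := measurable_quadraticVelocity hm hd φ
  have bX := lintegral_sq_angularVelocity_lt_top hS hρ hdeg hm hd T
  have bY := lintegral_sq_quadraticVelocity_lt_top hS hρ hm hd φ T
  set D : Ω → ℝ := fun ω => ∫ s in Set.Ioc 0 T, angularVelocity f s ω with hD
  set Q : Ω → ℝ := fun ω => ∫ s in Set.Ioc 0 T, quadraticVelocity f φ s ω with hQ
  have hwind : (fun ω => winding (fun t => f t ω) T) = D := by
    ext ω
    rw [winding, intervalIntegral.integral_of_le hT.le]
    rfl
  have LD : MemLp D 2 P := memLp_two_integral mX bX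
  have LQ : MemLp Q 2 P := memLp_two_integral mY bY
  rw [hwind]
  refine ⟨LD, ?_⟩
  set V := ∫ y : ℝ × ℝ, quadraticKernel ρ φ (y.1 - y.2)
        ∂((volume.restrict (Set.Ioc 0 T)).prod (volume.restrict (Set.Ioc 0 T))) with hV
  have hDQ : ∫ ω, D ω * Q ω ∂P = V := by
    rw [integral_mul_time_integrals mX mY bX bY]
    simp only [integral_angularVelocity_mul hS hρ hd', hφ, hV]
  have hQQ : ∫ ω, Q ω * Q ω ∂P = V := by
    rw [integral_mul_time_integrals mY mY bY bY]
    simp only [integral_quadraticVelocity_mul hS hρ hd', hφ, hV]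
  have hQ0 : ∫ ω, Q ω ∂P = 0 := by
    -- With the constant integrand `1`, the Fubini lemma yields `T · E[Q] = 0`.
    have h := integral_mul_time_integrals (P := P) (X := fun _ _ => (1 : ℝ)) (by fun_prop) mY
      (I := Set.Ioc 0 T) (by simp) bY
    simp only [one_mul, hφ, (integral_quadraticVelocity hS hρ hd' _).2, integral_zero] at h
    rw [integral_const_mul] at h
    simpa [hT.le, hT.ne'] using h
  set m := ∫ ω, D ω ∂P with hm'
  rw [variance_eq_integral LD.aestronglyMeasurable.aemeasurable]
  have iDQ : Integrable (fun ω => D ω * Q ω) P := LD.integrable_mul LQ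
  have iQ : Integrable Q P := LQ.integrable (by norm_num)
  have iQQ : Integrable (fun ω => Q ω * Q ω) P := LQ.integrable_mul LQ
  have iD2 : Integrable (fun ω => (D ω - m) ^ 2) P := (LD.sub (memLp_const m)).integrable_sq
  have iA : Integrable (fun ω => 2 * (D ω * Q ω) - 2 * m * Q ω) P :=
    (iDQ.const_mul 2).sub (iQ.const_mul (2 * m))
  -- With `E[DQ] = E[Q²] = V` and `E[Q] = 0`, the mean of `2(D - m)Q - Q²` is `V`; pointwise it is
  -- at most `(D - m)²`.
  calc V = ∫ ω, (2 * (D ω * Q ω) - 2 * m * Q ω - Q ω * Q ω) ∂P := by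
        rw [integral_sub iA iQQ, integral_sub (iDQ.const_mul 2) (iQ.const_mul (2 * m)),
          integral_const_mul, integral_const_mul, hDQ, hQQ, hQ0]
        ring
    _ ≤ ∫ ω, (D ω - m) ^ 2 ∂P := by
        refine integral_mono (iA.sub iQQ) iD2 fun ω => ?_
        simp only
        nlinarith [sq_nonneg (D ω - m - Q ω)]

end Winding

theorem theorem1p2 (r : ℝ → ℂ) (ρ : Measure ℝ) (hρ : IsSpectralMeasure r ρ)
    (hlog : LogMomentCondition ρ) (hdeg : ¬ IsDegenerate ρ) :
    ∃ C : ℝ, 0 < C ∧ ∃ T₀ : ℝ, 0 < T₀ ∧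
      ∀ (Ω : Type*) [MeasurableSpace Ω] (P : Measure Ω) [IsProbabilityMeasure P]
        (f : ℝ → Ω → ℂ),
        IsGSP f P →
        (∀ t : ℝ, covarianceKernel f P t = r t) →
        (∀ᵐ ω ∂P, ContDiff ℝ 1 (fun t : ℝ => f t ω)) →
        ∀ T : ℝ, T₀ ≤ T →
          MemLp (fun ω => winding (fun t : ℝ => f t ω) T) 2 P ∧
          C * T ≤ variance (fun ω => winding (fun t : ℝ => f t ω) T) P := by
  have := hρ.1
  have hL := hlog.memLp
  -- The constant is extracted from `ρ` alone, before any probability space or process is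
  -- introduced.
  obtain ⟨C, hC, hCT⟩ := exists_linear_le_integral_quadraticKernel hL hdeg (∫ l, l ∂ρ)
  refine ⟨C, hC, 1, one_pos, fun Ω _ P _ f hf hr hd T hT => ?_⟩
  obtain ⟨g, hgm, hgd, hfg⟩ := exists_smooth_modification hf.aemeasurable hd
  have hg := hf.congr hfg
  have hrg : ∀ t, covarianceKernel g P t = r t := fun t => by
    rw [← hr t, covarianceKernel, covarianceKernel]
    refine integral_congr_ae ?_
    filter_upwards [hfg] with ω hω
    rw [hω, hω]
  have hS := hg.isIsonormal_processSpan hρ hrg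
  obtain ⟨h1, h2⟩ := memLp_winding_and_variance_ge hS hL hdeg hgm hgd (T := T) (by linarith)
  have he : (fun ω => winding (fun t => g t ω) T) =ᵐ[P] fun ω => winding (fun t => f t ω) T := by
    filter_upwards [hfg] with ω hω
    rw [funext hω]
  exact ⟨h1.ae_eq he, variance_congr he ▸ (hCT T hT).trans h2⟩
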